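/- Let $L$ be a first-order language, $T$ a complete $L$-theory, $\kappa\ge\aleph_1$ a cardinal, and $\mathfrak C$ a $\kappa$-saturated model of $T$. Let $A\subseteq\mathfrak C$ with $|A|<\kappa$, and let $\pi(\overline y)$, with $\overline y$ a finite tuple of variables, be a partial type over $A$, that is, a set of $L(A)$-formulas that is consistent (finitely satisfiable in $\mathfrak C$). Write $\pi(\mathfrak C)$ for its set of realizations in $\mathfrak C$. *Op-dimension.* An IRD-pattern of depth $m<\omega$ and length $\omega$ in $\pi$ consists of $L(\mathfrak C)$-formulas $\varphi_i(\overline y,\overline z_i)$ for $i<m$ and tuples $\overline c_{i,j}\in\mathfrak C^{|\overline z_i|}$ for $i<m$, $j<\omega$, such that for every $g:m\to\omega$ the set $$\pi(\overline y)\cup\{\varphi_i(\overline y,\overline c_{i,j}) : i<m,\ j<\omega,\ g(i)<j\}\cup\{\neg\varphi_i(\overline y,\overline c_{i,j}) : i<m,\ j<\omega,\ g(i)\ge j\}$$ is consistent. The op-dimension $\mathrm{opDim}(\pi)\in\{0,1,2,\dots,\infty\}$ is the largest $m$ such that $\pi$ has an IRD-pattern of depth $m$ and length $\omega$, and $\infty$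 if there is no largest one. *Linear-order rank.* For $m\ge 1$ let $\mathbf{LO}^{*m}$ be the class of finite sets equipped with $m$ strict linear orders $<_0,\dots,<_{m-1}$ (in the language with $m$ binary relation symbols), and let $\Gamma_m$ be its Fraïssé limit. An $\mathbf{LO}^{*m}$-configuration into $\pi$ is a function $f:\Gamma_m\to\pi(\mathfrak C)$ such that for each $i<m$ there is an $L(\mathfrak C)$-formula $\varphi_i(\overline y_0,\overline y_1)$ with $$\Gamma_m\models a<_i b\iff \mathfrak C\models\varphi_i(f(a),f(b))\qquad\text{for all }a,b\in\Gamma_m .$$ The rank $\mathrm{Rk}_{\mathbf{LO}}(\pi)$ is $0$ if there is no $\mathbf{LO}^{*1}$-configuration into $\pi$; it is $n\ge1$ if there is an $\mathbf{LO}^{*n}$-configuration but no $\mathbf{LO}^{*(n+1)}$-configuration into $\pi$; and it is $\infty$ if there is an $\mathbf{LO}^{*n}$-configuration into $\pi$ for every $n\ge1$. **Proposition.** If $T$ has NIP (every partitioned $L$-formula $\varphi(\overline x;\overline y)$ has finite VC-dimension in the models of $T$), then for every partial type $\pi$ as above $$\mathrm{Rk}_{\mathbf{LO}}(\pi)=\mathrm{opDim}(\pi).$$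 -/

import Mathlib

open FirstOrder FirstOrder.Language CategoryTheory Cardinal

universe u v w

namespace KRank



section Types

variable {L : FirstOrder.Language.{u, v}}

/-- A set of formulas is finitely satisfiable in `M`: each finite subset has a realization in `M`.
For sets of formulas with parameters in `M` this is consistency with the elementary diagram
of `M`. -/
def FinitelySatisfiable (M : Type w) [L.Structure M] {α : Type*} (p : Set (L.Formula α)) : Prop :=
  ∀ F : Set (L.Formula α), F ⊆ p → F.Finite → ∃ a : α → M, ∀ φ ∈ F, φ.Realize a

/-- The set `p(M)` of realizations of `p` in `M`. -/
def realizations (M : Type w) [L.Structure M] {α : Type*} (p : Set (L.Formula α)) :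
    Set (α → M) :=
  {a | ∀ φ ∈ p, φ.Realize a}

/-- `M` is `κ`-saturated: each consistent set of formulas in one variable over fewer than `κ`
parameters is realized in `M`. -/
def IsSaturated (L : FirstOrder.Language.{u, v}) (M : Type w) [L.Structure M] (κ : Cardinal.{w}) : Prop :=
  ∀ A : Set M, #A < κ → ∀ p : Set (L[[A]].Formula (Fin 1)),
    FinitelySatisfiable M p → (realizations M p).Nonempty

/-- The formula `φ(x; y)` shatters some `k` many tuples `a 0, …, a (k-1)` of `M`. -/
def Shatters (M : Type w) [L.Structure M] {n m : ℕ} (φ : L.Formula (Fin n ⊕ Fin m)) (k : ℕ) :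
    Prop :=
  ∃ a : Fin k → Fin n → M, ∀ s : Set (Fin k), ∃ b : Fin m → M,
    ∀ i, φ.Realize (Sum.elim (a i) b) ↔ i ∈ s

/-- `T` has NIP: each partitioned formula has finite VC-dimension in the models of `T`. -/
def IsNIP (T : L.Theory) : Prop :=
  ∀ (n m : ℕ) (φ : L.Formula (Fin n ⊕ Fin m)), ∃ k : ℕ,
    ∀ (M : Type w) [L.Structure M] [Nonempty M] [M ⊨ T], ¬ Shatters M φ k

end Types

section OpDimension

variable {L : FirstOrder.Language.{u, v}} {M : Type w} [L.Structure M]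

/-- A set of `L(A)`-formulas seen as a set of `L(M)`-formulas. -/
def liftParams {A : Set M} {α : Type*} (π : Set (L[[A]].Formula α)) : Set (L[[M]].Formula α) :=
  (L.lhomWithConstantsMap (Subtype.val : A → M)).onFormula '' π

/-- The `L(M)`-formula `φ(y, c)` obtained from `φ(y, z)` by substituting the tuple `c` for `z`. -/
def plugIn {α β : Type*} (φ : L[[M]].Formula (α ⊕ β)) (c : β → M) : L[[M]].Formula α :=
  BoundedFormula.subst φ (Sum.elim (fun i => Term.var i) (fun j => (L.con (c j)).term))

open Classical in
/-- `φ` if `P` is true, and `¬ φ` if `P` is false. -/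
noncomputable def formulaIff {α : Type*} (φ : L[[M]].Formula α) (P : Prop) : L[[M]].Formula α :=
  if P then φ else φ.not

/-- `π` has an IRD-pattern of depth `m` and length `ω`. -/
def HasIRDPattern {A : Set M} {d : ℕ} (π : Set (L[[A]].Formula (Fin d))) (m : ℕ) : Prop :=
  ∃ (k : Fin m → ℕ) (φ : ∀ i, L[[M]].Formula (Fin d ⊕ Fin (k i)))
    (c : ∀ i, ℕ → Fin (k i) → M),
    ∀ g : Fin m → ℕ, FinitelySatisfiable M
      (liftParams π ∪ {ψ | ∃ (i : Fin m) (j : ℕ), ψ = formulaIff (plugIn (φ i) (c i j)) (g i < j)})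

/-- The op-dimension of `π`: the largest depth of an IRD-pattern of length `ω` in `π`, and `∞` if
there are such patterns of arbitrarily large depth. -/
noncomputable def opDim {A : Set M} {d : ℕ} (π : Set (L[[A]].Formula (Fin d))) : ℕ∞ :=
  ⨆ (m : ℕ) (_ : HasIRDPattern π m), (m : ℕ∞)

end OpDimension

section Superposition

/-- The relational language whose signature is the disjoint union of `n` copies of the signature
of the relational language `L₀`. -/
def copies (L₀ : FirstOrder.Language.{0, 0}) (n : ℕ) : FirstOrder.Language.{0, 0} where
  Functions := fun _ => Empty
  Relations := fun k => Fin n × L₀.Relations k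

instance (L₀ : FirstOrder.Language.{0, 0}) (n : ℕ) : (copies L₀ n).IsRelational :=
  fun _ => inferInstanceAs (IsEmpty Empty)

instance (L₀ : FirstOrder.Language.{0, 0}) (n : ℕ) : Countable (Σ l, (copies L₀ n).Functions l) :=
  ⟨fun _ => 0, fun a => isEmptyElim a.2⟩

/-- The inclusion of `L₀` as the `i`-th copy. -/
def copyHom (L₀ : FirstOrder.Language.{0, 0}) [L₀.IsRelational] (n : ℕ) (i : Fin n) :
    L₀ →ᴸ copies L₀ n where
  onFunction := fun _ f => isEmptyElim f
  onRelation := fun _ R => (i, R)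

/-- The `n`-fold free superposition `K^{*n}` of `K` with itself: the finite structures each of whose
`n` reducts to a copy of `L₀` is in `K`. -/
def starPow {L₀ : FirstOrder.Language.{0, 0}} [L₀.IsRelational] (K : Set (Bundled.{0} L₀.Structure)) (n : ℕ) :
    Set (Bundled.{0} (copies L₀ n).Structure) :=
  {B | Finite B ∧ ∀ i : Fin n, (⟨B, (copyHom L₀ n i).reduct B⟩ : Bundled.{0} L₀.Structure) ∈ K}

end Superposition

section Rank

variable {L : FirstOrder.Language.{u, v}} {M : Type w} [L.Structure M]

/-- `f` is a configuration of the `L₀`-structure `Γ` into `π`: it maps `Γ` into `π(M)`, and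
each relation of `Γ` is the pullback along `f` of an `L(M)`-definable relation. -/
def IsConfiguration {L₀ : FirstOrder.Language.{0, 0}} {Γ : Type} [L₀.Structure Γ] {A : Set M} {d : ℕ}
    (π : Set (L[[A]].Formula (Fin d))) (f : Γ → Fin d → M) : Prop :=
  (∀ a, f a ∈ realizations M π) ∧
  ∀ (n : ℕ) (R : L₀.Relations n), ∃ φ : L[[M]].Formula (Fin n × Fin d),
    ∀ a : Fin n → Γ, Structure.RelMap R a ↔ φ.Realize (fun q => f (a q.1) q.2)

/-- There is a `K`-configuration into `π`, that is, a configuration of the Fraïssé limit of `K`. -/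
def HasConfiguration {L₀ : FirstOrder.Language.{0, 0}} [Countable (Σ l, L₀.Functions l)]
    (K : Set (Bundled.{0} L₀.Structure)) {A : Set M} {d : ℕ}
    (π : Set (L[[A]].Formula (Fin d))) : Prop :=
  ∃ (Γ : Type) (_ : L₀.Structure Γ) (_ : Countable Γ), IsFraisseLimit K Γ ∧
    ∃ f : Γ → Fin d → M, IsConfiguration (L₀ := L₀) π f

/-- The `K`-rank of `π`: the least `n` such that there is no `K^{*(n+1)}`-configuration into `π`,
and `∞` if there are `K^{*n}`-configurations into `π` for all `n ≥ 1`. -/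
noncomputable def rank {L₀ : FirstOrder.Language.{0, 0}} [L₀.IsRelational]
    (K : Set (Bundled.{0} L₀.Structure)) {A : Set M} {d : ℕ}
    (π : Set (L[[A]].Formula (Fin d))) : ℕ∞ :=
  ⨅ (n : ℕ) (_ : ¬ HasConfiguration (starPow K (n + 1)) π), (n : ℕ∞)

theorem rank_eq_top_iff {L₀ : FirstOrder.Language.{0, 0}} [L₀.IsRelational]
    (K : Set (Bundled.{0} L₀.Structure)) {A : Set M} {d : ℕ}
    (π : Set (L[[A]].Formula (Fin d))) :
    rank K π = ⊤ ↔ ∀ n : ℕ, 1 ≤ n → HasConfiguration (starPow K n) π := by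
  simp only [rank, iInf_eq_top, ENat.natCast_ne_top, imp_false, not_not]
  refine ⟨fun h n hn => ?_, fun h n => h _ (Nat.le_add_left 1 n)⟩
  obtain ⟨k, rfl⟩ := Nat.exists_eq_add_of_le' hn
  exact h k

theorem rank_spec {L₀ : FirstOrder.Language.{0, 0}} [L₀.IsRelational]
    (K : Set (Bundled.{0} L₀.Structure)) {A : Set M} {d : ℕ}
    (π : Set (L[[A]].Formula (Fin d))) {n : ℕ} (h : rank K π = n) :
    (1 ≤ n → HasConfiguration (starPow K n) π) ∧ ¬ HasConfiguration (starPow K (n + 1)) π := by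
  have hle : ∀ k : ℕ, ¬ HasConfiguration (starPow K (k + 1)) π → n ≤ k := fun k hk => by
    have : rank K π ≤ k := iInf₂_le k hk
    rw [h] at this
    exact_mod_cast this
  constructor
  · intro hn
    obtain ⟨k, rfl⟩ := Nat.exists_eq_add_of_le' hn
    by_contra hk
    have := hle k hk
    omega
  · intro hc
    have : ((n + 1 : ℕ) : ℕ∞) ≤ rank K π := le_iInf₂ fun k hk => by
      have h1 := hle k hk
      have h2 : n ≠ k := fun e => hk (e ▸ hc)
      exact_mod_cast (by omega : n + 1 ≤ k)
    rw [h] at this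
    have : n + 1 ≤ n := by exact_mod_cast this
    omega

end Rank

section LinearOrders

/-- The relation symbols of the language with a single, binary relation symbol. -/
inductive BinRel : ℕ → Type
  | lt : BinRel 2

/-- The language with a single binary relation symbol. -/
def binLang : FirstOrder.Language.{0, 0} where
  Functions := fun _ => Empty
  Relations := BinRel

instance : binLang.IsRelational :=
  fun _ => inferInstanceAs (IsEmpty Empty)

/-- The interpretation of the binary relation symbol. -/
def ltOn (B : Type) [binLang.Structure B] (a b : B) : Prop :=
  Structure.RelMap (L := binLang) BinRel.lt ![a, b]

/-- The class `LO` of finite strict linear orders: irreflexive, transitive, trichotomous. -/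
def LO : Set (Bundled.{0} binLang.Structure) :=
  {B | Finite B ∧ (∀ a : B, ¬ ltOn B a a) ∧
    (∀ a b c : B, ltOn B a b → ltOn B b c → ltOn B a c) ∧
    (∀ a b : B, a ≠ b → Xor (ltOn B a b) (ltOn B b a))}

end LinearOrders

end KRank

/-!
A configuration of the Fraïssé limit `Γ` of the finite sets with `m` linear orders contains an
IRD-pattern of depth `m` without any hypothesis on the structure: each countable set with `m` linear
orders embeds into `Γ`, in particular one having points `p i j` and `r g` with
`r g <ᵢ p i j ↔ g i < j`.

For the converse, realize the branches `g : m → ω` of an IRD-pattern by tuples `a g`, and take a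
grid `b : ℚ^m → π(M)` that realizes the EM-type of `a` and is indiscernible: the type of finitely
many `b x` depends only on the order type of each of the `m` tuples of coordinates. It comes from
an iterated ultrafilter on `ω`. By saturation the `i`-th formula of the pattern still cuts the grid
at each value of the `i`-th coordinate. The sign type of a pair `x, y` records for each `i` whether
`x i < y i`. If two sign types with different `i`-th signs could not be told apart over finitely
many points of the grid, then restrict the grid to the plane through the origin spanned by the two
sign types. There, two points could be exchanged for two points with the opposite `i`-th order
without affecting definable sets, so that a cut could be split further and further, in
contradiction to finite VC-dimension. So NIP yields definable separations of the sign types, which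
are uniform near the origin by indiscernibility, and combine to definitions of the `m` axis orders
on pairs of points near the origin which differ in all coordinates or in none. Embedding each of
the orders of `Γ` into a short interval of rational numbers gives the configuration.
-/

namespace KRank

section Definability

variable {L : FirstOrder.Language.{u, v}} {M : Type w} [L.Structure M] {α β : Type*}

theorem isExpansionOn_lhomWithConstantsMap [(constantsOn α).Structure M]
    [(constantsOn β).Structure M] (f : α → β) [(LHom.constantsOnMap f).IsExpansionOn M] :
    (L.lhomWithConstantsMap f).IsExpansionOn M :=
  LHom.sumMap_isExpansionOn _ _ M

theorem realize_onFormula_val {A : Set M} (φ : L[[A]].Formula α) (x : α → M) :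
    ((L.lhomWithConstantsMap (Subtype.val : A → M)).onFormula φ).Realize x ↔ φ.Realize x :=
  have : (LHom.constantsOnMap (Subtype.val : A → M)).IsExpansionOn M :=
    constantsOnMap_isExpansionOn rfl
  have := isExpansionOn_lhomWithConstantsMap (L := L) (M := M) (Subtype.val : A → M)
  LHom.realize_onFormula _ φ

theorem realize_plugIn (φ : L[[M]].Formula (α ⊕ β)) (c : β → M) (x : α → M) :
    (plugIn φ c).Realize x ↔ φ.Realize (Sum.elim x c) := by
  have hsubst : (fun i => (Sum.elim (fun i => Term.var i)
      (fun j => (L.con (c j)).term) i : L[[M]].Term α).realize x) = Sum.elim x c := by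
    ext (i | j)
    · rfl
    · exact Term.realize_constants
  rw [Formula.Realize, plugIn, BoundedFormula.realize_subst, hsubst, Formula.Realize]

theorem realize_formulaIff (φ : L[[M]].Formula α) (P : Prop) (x : α → M) :
    (formulaIff φ P).Realize x ↔ (φ.Realize x ↔ P) := by
  unfold formulaIff
  split_ifs with h <;> simp [h]

theorem definable_univ_iff {D : Set (α → M)} :
    (Set.univ : Set M).Definable L D ↔ ∃ φ : L[[M]].Formula α, ∀ x, φ.Realize x ↔ x ∈ D := by
  constructor
  · rintro ⟨φ, rfl⟩
    exact ⟨_, fun x => realize_onFormula_val φ x⟩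
  · rintro ⟨φ, hφ⟩
    let toUniv : M → (Set.univ : Set M) := fun a => ⟨a, trivial⟩
    have : (LHom.constantsOnMap toUniv).IsExpansionOn M := constantsOnMap_isExpansionOn rfl
    have := isExpansionOn_lhomWithConstantsMap (L := L) (M := M) toUniv
    refine ⟨(L.lhomWithConstantsMap toUniv).onFormula φ, ?_⟩
    ext x
    rw [← hφ]
    exact (LHom.realize_onFormula _ φ).symm

theorem definable_iff_mem_iff {B : Set M} {D : Set (α → M)} (hD : B.Definable L D) (P : Prop) :
    B.Definable L {x | x ∈ D ↔ P} := by
  by_cases hP : P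
  · simpa only [hP, iff_true] using! hD
  · simpa only [hP, iff_false] using! hD.compl

theorem exists_definable_restrict {B : Set M} {D : Set (α → M)} (hD : B.Definable L D) :
    ∃ (S : Finset α) (D' : Set (S → M)), B.Definable L D' ∧
      ∀ x : α → M, x ∈ D ↔ S.restrict x ∈ D' := by
  classical
  obtain ⟨φ, rfl⟩ := hD
  exact ⟨φ.freeVarFinset, {x | Formula.Realize (φ.restrictFreeVar id) x}, ⟨_, rfl⟩,
    fun x => (BoundedFormula.realize_restrictFreeVar (f := id) x fun _ => rfl).symm⟩

/-- `Set.Definable.image_comp` without a finiteness assumption on the source tuples. -/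
theorem definable_image_comp {B : Set M} {D : Set (β → M)} (hD : B.Definable L D) (f : α → β)
    [Finite α] : B.Definable L ((· ∘ f) '' D) := by
  classical
  rcases D.eq_empty_or_nonempty with rfl | ⟨x₀, -⟩
  · simp [Set.definable_empty]
  cases nonempty_fintype α
  obtain ⟨S, D', hD', hrestrict⟩ := exists_definable_restrict hD
  let S' : Finset β := S ∪ Finset.univ.image f
  have hS : S ⊆ S' := Finset.subset_union_left
  have hf : ∀ i, f i ∈ S' := fun i => by simp [S']
  convert! (hD'.preimage_comp fun i : S => (⟨i, hS i.2⟩ : S')).image_comp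
    fun i => (⟨f i, hf i⟩ : S') using 1
  ext y
  constructor
  · rintro ⟨x, hx, rfl⟩
    exact ⟨S'.restrict x, (hrestrict x).1 hx, rfl⟩
  · rintro ⟨x, hx, rfl⟩
    let x' : β → M := fun i => if hi : i ∈ S' then x ⟨i, hi⟩ else x₀ i
    have hx' : S.restrict x' = x ∘ fun i : S => (⟨i, hS i.2⟩ : S') :=
      funext fun i => dif_pos (hS i.2)
    exact ⟨x', (hrestrict x').2 (hx' ▸ hx), funext fun i => dif_pos (hf i)⟩

theorem definable_exists_pattern {ι γ : Type*} [Finite ι] [Finite γ] {B : Set M}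
    {D : Set (α ⊕ γ → M)} (hD : B.Definable L D) (P : ι → Prop) :
    B.Definable L {x : ι × α → M | ∃ z : γ → M,
      ∀ j, Sum.elim (fun q => x (j, q)) z ∈ D ↔ P j} := by
  have hfiber (j : ι) : B.Definable L
      {x : (ι × α) ⊕ γ → M | x ∘ Sum.map (Prod.mk j) id ∈ D ↔ P j} :=
    definable_iff_mem_iff (hD.preimage_comp _) (P j)
  convert! (Set.definable_iInter_of_finite hfiber).exists_of_finite using 1
  ext x
  simp only [Set.mem_ofPred_eq, Set.mem_iInter, Sum.elim_comp_map, Function.comp_id]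
  rfl

end Definability

section FiniteVCDimension

variable {L : FirstOrder.Language.{u, v}} {M : Type w} {α β : Type*}

/-- The relation `D` between `α`-tuples and `β`-tuples has finite VC-dimension: for some `k` it does
not cut out all subsets of any `k` many `α`-tuples. -/
def HasFiniteVCDim (D : Set (α ⊕ β → M)) : Prop :=
  ∃ k : ℕ, ¬ ∃ a : Fin k → α → M, ∀ s : Set (Fin k), ∃ b : β → M,
    ∀ i, Sum.elim (a i) b ∈ D ↔ i ∈ s

/-- NIP for a single structure: each partitioned formula without parameters has finite VC-dimension
in `M`. -/
def IsNIPStructure (L : FirstOrder.Language.{u, v}) (M : Type w) [L.Structure M] : Prop :=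
  ∀ (n m : ℕ) (φ : L.Formula (Fin n ⊕ Fin m)), ∃ k : ℕ, ¬ Shatters M φ k

variable [L.Structure M]

theorem IsNIPStructure.hasFiniteVCDim (hNIP : IsNIPStructure L M) {n m : ℕ}
    {D : Set (Fin n ⊕ Fin m → M)} (hD : (Set.univ : Set M).Definable L D) : HasFiniteVCDim D := by
  obtain ⟨A, -, hA⟩ := Set.definable_iff_finitely_definable.1 hD
  obtain ⟨φ, rfl⟩ := Set.definable_iff_exists_formula_sum.1 hA
  -- The parameters become part of the second block of variables.
  let e : (A : Set M) ≃ Fin A.card := A.equivFin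
  let r : (A : Set M) ⊕ (Fin n ⊕ Fin m) → Fin n ⊕ Fin (m + A.card) :=
    Sum.elim (fun x => Sum.inr (Fin.natAdd m (e x)))
      (Sum.elim Sum.inl fun j => Sum.inr (Fin.castAdd A.card j))
  obtain ⟨k, hk⟩ := hNIP n (m + A.card) (φ.relabel r)
  refine ⟨k, fun ⟨a, ha⟩ => hk ⟨a, fun s => ?_⟩⟩
  obtain ⟨b, hb⟩ := ha s
  refine ⟨Fin.append b fun j => (e.symm j : M), fun i => ?_⟩
  have hrelabel : Sum.elim (a i) (Fin.append b fun j => (e.symm j : M)) ∘ r =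
      Sum.elim Subtype.val (Sum.elim (a i) b) := by
    ext (x | x | x) <;> simp [r]
  rw [← hb i, Formula.realize_relabel, hrelabel]
  rfl

end FiniteVCDimension

section Saturation

variable {L : FirstOrder.Language.{u, v}} {M : Type w} {α : Type*}

theorem mk_union_countable_lt {κ : Cardinal.{w}} (hκ : ℵ_ 1 ≤ κ) {B C : Set M} (hB : #B < κ)
    (hC : C.Countable) : #(B ∪ C : Set M) < κ :=
  have hℵ₀ : ℵ₀ < κ := aleph0_lt_aleph_one.trans_le hκ
  (mk_union_le B C).trans_lt (add_lt_of_lt hℵ₀.le hB (hC.le_aleph0.trans_lt hℵ₀))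

theorem exists_seq_of_forall_exists_update {Q : ℕ → (ℕ → M) → Prop}
    (hcongr : ∀ n a b, (∀ i < n, a i = b i) → Q n a → Q n b) (hzero : ∃ a, Q 0 a)
    (hsucc : ∀ n a, Q n a → ∃ c, Q (n + 1) (Function.update a n c)) : ∃ a, ∀ n, Q n a := by
  obtain ⟨a₀, ha₀⟩ := hzero
  have : Nonempty M := ⟨a₀ 0⟩
  choose! next hnext using hsucc
  let approx : ℕ → ℕ → M :=
    fun n => Nat.rec a₀ (fun n a => Function.update a n (next n a)) n
  have happrox : ∀ n, Q n (approx n) := fun n => Nat.rec ha₀ (fun n ih => hnext n _ ih) n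
  have hstable : ∀ n, ∀ i < n, approx n i = approx (i + 1) i := by
    intro n
    induction n with
    | zero => exact fun i hi => absurd hi i.not_lt_zero
    | succ n ih =>
      intro i hi
      rcases Nat.lt_succ_iff_lt_or_eq.1 hi with hin | rfl
      · exact (Function.update_of_ne hin.ne _ _).trans (ih i hin)
      · rfl
  exact ⟨fun i => approx (i + 1) i, fun n => hcongr n _ _ (hstable n) (happrox n)⟩

variable [L.Structure M]

theorem IsSaturated.exists_extension {κ : Cardinal.{w}} (hM : IsSaturated L M κ) (hκ : ℵ_ 1 ≤ κ)
    {B : Set M} (hB : #B < κ) {F : Filter (ℕ → M)} {n : ℕ} {a : ℕ → M}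
    (ha : ∀ D ∈ F, B.Definable L D → ∃ x ∈ D, ∀ i < n, x i = a i) :
    ∃ c : M, ∀ D ∈ F, B.Definable L D → ∃ x ∈ D, (∀ i < n, x i = a i) ∧ x n = c := by
  let C : Set M := B ∪ a '' Set.Iio n
  let P (D : Set (ℕ → M)) : Set (Fin 1 → M) :=
    (· ∘ fun _ => n) '' (D ∩ ⋂ i : Set.Iio n, {x | x i = a i})
  have hP (D) (hD : B.Definable L D) : C.Definable L (P D) :=
    definable_image_comp ((hD.mono Set.subset_union_left).inter
      (Set.definable_iInter_of_finite fun i =>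
        (Set.DefinableFun.proj L).ofPred_eq_const (Or.inr (Set.mem_image_of_mem a i.2)))) _
  let p : Set (L[[C]].Formula (Fin 1)) :=
    {φ | ∃ D ∈ F, B.Definable L D ∧ P D = {y | φ.Realize y}}
  have hp : FinitelySatisfiable M p := by
    intro Φ hΦ hfin
    choose! D hDF hDB hDφ using fun φ (hφ : φ ∈ Φ) => hΦ hφ
    have := hfin.to_subtype
    obtain ⟨x, hx, hxa⟩ := ha (⋂ φ : Φ, D φ) (Filter.iInter_mem.2 fun φ => hDF φ φ.2)
      (Set.definable_iInter_of_finite fun φ => hDB φ φ.2)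
    refine ⟨fun _ => x n, fun φ hφ => ?_⟩
    suffices (fun _ => x n) ∈ P (D φ) by rwa [hDφ φ hφ] at this
    exact ⟨x, ⟨Set.mem_iInter.1 hx ⟨φ, hφ⟩, Set.mem_iInter.2 fun i => hxa i i.2⟩, rfl⟩
  obtain ⟨y, hy⟩ := hM C (mk_union_countable_lt hκ hB ((Set.finite_Iio n).image a).countable) p hp
  refine ⟨y 0, fun D hDF hDB => ?_⟩
  obtain ⟨φ, hφ⟩ := hP D hDB
  obtain ⟨x, ⟨hxD, hxa⟩, hxy⟩ : y ∈ P D := hφ ▸ hy φ ⟨D, hDF, hDB, hφ⟩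
  exact ⟨x, hxD, fun i hi => Set.mem_iInter.1 hxa ⟨i, hi⟩, congrFun hxy 0⟩

theorem IsSaturated.exists_forall_mem_nat {κ : Cardinal.{w}} (hM : IsSaturated L M κ)
    (hκ : ℵ_ 1 ≤ κ) {B : Set M} (hB : #B < κ) (F : Filter (ℕ → M)) [F.NeBot] :
    ∃ a, ∀ D ∈ F, B.Definable L D → a ∈ D := by
  obtain ⟨a, ha⟩ := exists_seq_of_forall_exists_update
    (Q := fun n a => ∀ D ∈ F, B.Definable L D → ∃ x ∈ D, ∀ i < n, x i = a i)
    (fun n a b hab ha D hDF hDB =>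
      (ha D hDF hDB).imp fun x hx => ⟨hx.1, fun i hi => (hx.2 i hi).trans (hab i hi)⟩)
    (F.nonempty_of_neBot.elim fun a => ⟨a, fun _ hDF _ => (Filter.nonempty_of_mem hDF).imp
      fun _ hx => ⟨hx, fun i hi => absurd hi i.not_lt_zero⟩⟩)
    (fun n a ha => (hM.exists_extension hκ hB ha).imp fun c hc D hDF hDB =>
      (hc D hDF hDB).imp fun x ⟨hxD, hxa, hxc⟩ => ⟨hxD, fun i hi => by
        rcases Nat.lt_succ_iff_lt_or_eq.1 hi with hin | rfl
        · rw [hxa i hin, Function.update_of_ne hin.ne]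
        · rw [hxc, Function.update_self]⟩)
  refine ⟨a, fun D hDF hDB => ?_⟩
  obtain ⟨S, D', -, hrestrict⟩ := exists_definable_restrict hDB
  obtain ⟨x, hxD, hxa⟩ := ha (S.sup id + 1) D hDF hDB
  have hS : S.restrict x = S.restrict a :=
    funext fun i => hxa i (Nat.lt_succ_of_le (Finset.le_sup (f := id) i.2))
  rwa [hrestrict, ← hS, ← hrestrict]

theorem IsSaturated.exists_forall_mem [Countable α] {κ : Cardinal.{w}} (hM : IsSaturated L M κ)
    (hκ : ℵ_ 1 ≤ κ) {B : Set M} (hB : #B < κ) (F : Filter (α → M)) [F.NeBot] :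
    ∃ a, ∀ D ∈ F, B.Definable L D → a ∈ D := by
  obtain ⟨f, hf⟩ := exists_injective_nat α
  rcases isEmpty_or_nonempty M with hM₀ | hM₀
  · obtain ⟨a⟩ := F.nonempty_of_neBot
    have : IsEmpty α := ⟨fun i => hM₀.false (a i)⟩
    exact ⟨a, fun D hDF _ => Subsingleton.mem_iff_nonempty.2 (Filter.nonempty_of_mem hDF)⟩
  have := Filter.NeBot.comap_of_surj ‹F.NeBot› (hf.surjective_comp_right (γ := M))
  obtain ⟨a, ha⟩ := hM.exists_forall_mem_nat hκ hB (F.comap fun x : ℕ → M => x ∘ f)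
  exact ⟨a ∘ f, fun D hDF hDB => ha _ (Filter.preimage_mem_comap hDF) (hDB.preimage_comp f)⟩

theorem IsSaturated.iInter_nonempty [Countable α] {κ : Cardinal.{w}} (hM : IsSaturated L M κ)
    (hκ : ℵ_ 1 ≤ κ) {B : Set M} (hB : #B < κ) {ι : Type*} {D : ι → Set (α → M)}
    (hD : ∀ j, B.Definable L (D j)) (hfin : ∀ T : Finset ι, (⋂ j ∈ T, D j).Nonempty) :
    (⋂ j, D j).Nonempty := by
  have : (⨅ j, Filter.principal (D j)).NeBot :=
    (Filter.hasBasis_iInf_principal_finite D).neBot_iff.2 fun {T} hT => by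
      simpa using hfin hT.toFinset
  obtain ⟨a, ha⟩ := hM.exists_forall_mem hκ hB (⨅ j, Filter.principal (D j))
  exact ⟨a, Set.mem_iInter.2 fun j =>
    ha _ (Filter.mem_iInf_of_mem j (Filter.mem_principal_self _)) (hD j)⟩

end Saturation

section PlanarSplittings

open Set

variable {α β : Type*} [LinearOrder α] [LinearOrder β]

/-- The intervals spanned by `{a, b}` and by `{c, d}` are disjoint. -/
def SepIntervals (a b c d : α) : Prop :=
  max a b < min c d ∨ max c d < min a b

/-- The points `a` and `b` lie on the same side of the open interval `(l, u)`. -/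
def OnOneSide (l u a b : α) : Prop :=
  max a b ≤ l ∨ u ≤ min a b

/-- The boxes spanned by two pairs of points of the plane have disjoint projections to both
axes. -/
def SepPairs (P Q : (α × β) × (α × β)) : Prop :=
  SepIntervals P.1.1 P.2.1 Q.1.1 Q.2.1 ∧ SepIntervals P.1.2 P.2.2 Q.1.2 Q.2.2

theorem SepPairs.symm {P Q : (α × β) × (α × β)} (h : SepPairs P Q) : SepPairs Q P :=
  ⟨Or.symm h.1, Or.symm h.2⟩

theorem SepPairs.lt_iff_lt {P Q : (α × β) × (α × β)} (h : SepPairs P Q) {p q : α × β}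
    (hp : p = P.1 ∨ p = P.2) (hq : q = Q.1 ∨ q = Q.2) :
    (p.1 < q.1 ↔ P.1.1 < Q.1.1) ∧ (p.2 < q.2 ↔ P.1.2 < Q.1.2) := by
  simp only [SepPairs, SepIntervals, max_lt_iff, lt_min_iff] at h
  grind

/-- The set `S` splits the list `l` of pairs of points, whose boxes have pairwise disjoint
projections: it contains the first point of each pair but not the second one. The lengths of such
lists play the role of the VC-dimension of `S`. -/
def IsSplitBy (S : Set (α × β)) (l : List ((α × β) × (α × β))) : Prop :=
  l.Pairwise SepPairs ∧ ∀ P ∈ l, P.1 ∈ S ∧ P.2 ∉ S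

theorem isSplitBy_nil (S : Set (α × β)) : IsSplitBy S [] :=
  ⟨List.Pairwise.nil, by simp⟩

theorem IsSplitBy.cons {S : Set (α × β)} {P : (α × β) × (α × β)} {l : List ((α × β) × (α × β))}
    (hl : IsSplitBy S l) (hP : P.1 ∈ S ∧ P.2 ∉ S) (hsep : ∀ Q ∈ l, SepPairs P Q) :
    IsSplitBy S (P :: l) :=
  ⟨List.pairwise_cons.2 ⟨hsep, hl.1⟩, List.forall_mem_cons.2 ⟨hP, hl.2⟩⟩

theorem sepIntervals_of_mem_Ioo {l u a b c d : α} (ha : a ∈ Ioo l u) (hb : b ∈ Ioo l u)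
    (hcd : OnOneSide l u c d) : SepIntervals a b c d := by
  simp only [mem_Ioo, OnOneSide, SepIntervals, max_le_iff, le_min_iff, max_lt_iff,
    lt_min_iff] at *
  grind

theorem exists_isSplitBy_of_forall_box [DenselyOrdered α] [DenselyOrdered β] {S : Set (α × β)}
    (n : ℕ) {a b : α} {c d : β} (hab : a < b) (hcd : c < d)
    (hS : ∀ a' b' c' d', a ≤ a' → a' < b' → b' ≤ b → c ≤ c' → c' < d' → d' ≤ d →
      (∃ p ∈ Ioo a' b' ×ˢ Ioo c' d', p ∈ S) ∧ ∃ q ∈ Ioo a' b' ×ˢ Ioo c' d', q ∉ S) :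
    ∃ l, IsSplitBy S l ∧ l.length = n ∧
      ∀ P ∈ l, P.1 ∈ Ioo a b ×ˢ Ioo c d ∧ P.2 ∈ Ioo a b ×ˢ Ioo c d := by
  induction n generalizing a c with
  | zero => exact ⟨[], isSplitBy_nil S, rfl, by simp⟩
  | succ n ih =>
    obtain ⟨e, hae, heb⟩ := exists_between hab
    obtain ⟨f, hcf, hfd⟩ := exists_between hcd
    obtain ⟨l, hl, hn, hlbox⟩ := ih heb hfd fun a' b' c' d' ha' hab' hb' hc' hcd' hd' =>
      hS a' b' c' d' (hae.le.trans ha') hab' hb' (hcf.le.trans hc') hcd' hd'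
    obtain ⟨⟨p, hp, hpS⟩, q, hq, hqS⟩ := hS a e c f le_rfl hae heb.le le_rfl hcf hfd.le
    refine ⟨(p, q) :: l, hl.cons ⟨hpS, hqS⟩ fun Q hQ => ?_, by simp [hn],
      List.forall_mem_cons.2 ⟨?_, fun Q hQ => ?_⟩⟩
    · have := hlbox Q hQ
      simp only [mem_prod, mem_Ioo, SepPairs, SepIntervals, max_lt_iff, lt_min_iff] at *
      grind
    · simp only [mem_prod, mem_Ioo] at *
      grind
    · have := hlbox Q hQ
      simp only [mem_prod, mem_Ioo] at *
      grind

theorem exists_constant_subbox [DenselyOrdered α] [DenselyOrdered β] {S : Set (α × β)} {k : ℕ}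
    (hS : ∀ l, IsSplitBy S l → l.length ≠ k) {a b : α} {c d : β} (hab : a < b) (hcd : c < d) :
    ∃ a' b' c' d', a ≤ a' ∧ a' < b' ∧ b' ≤ b ∧ c ≤ c' ∧ c' < d' ∧ d' ≤ d ∧
      ((∀ p ∈ Ioo a' b' ×ˢ Ioo c' d', p ∈ S) ∨ ∀ p ∈ Ioo a' b' ×ˢ Ioo c' d', p ∉ S) := by
  by_contra hcon
  obtain ⟨l, hl, hn, -⟩ := exists_isSplitBy_of_forall_box (S := S) k hab hcd
    fun a' b' c' d' h₁ h₂ h₃ h₄ h₅ h₆ => by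
      by_contra hsplit
      refine hcon ⟨a', b', c', d', h₁, h₂, h₃, h₄, h₅, h₆, ?_⟩
      rw [not_and_or] at hsplit
      push Not at hsplit
      exact hsplit.symm
  exact hS l hl hn

/-- The vertical cut of `S` between the abscissas `l₂` and `l₃`: over the interval `(j₀, j₁)`, the
set `S` contains everything above `(l₁, l₂)` and nothing above `(l₃, l₄)`. -/
structure IsCut (S : Set (α × β)) (l₁ l₂ l₃ l₄ : α) (j₀ j₁ : β) : Prop where
  lt_left : l₁ < l₂
  le_middle : l₂ ≤ l₃
  lt_right : l₃ < l₄
  lt_height : j₀ < j₁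
  mem : ∀ p ∈ Ioo l₁ l₂ ×ˢ Ioo j₀ j₁, p ∈ S
  notMem : ∀ p ∈ Ioo l₃ l₄ ×ˢ Ioo j₀ j₁, p ∉ S

/-- A set `S` with a cut inside a box, together with a list of pairs that `S` splits and whose
projections avoid those of the box. -/
structure IsCutSplitting (S : Set (α × β)) (l : List ((α × β) × (α × β))) (l₁ l₂ l₃ l₄ : α)
    (j₀ j₁ : β) : Prop extends IsCut S l₁ l₂ l₃ l₄ j₀ j₁ where
  isSplitBy : IsSplitBy S l
  onOneSide : ∀ P ∈ l, OnOneSide l₁ l₄ P.1.1 P.2.1 ∧ OnOneSide j₀ j₁ P.1.2 P.2.2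

/-- The set `S'` looks at the points `(s₂, t₁)` and `(s₁, t₂)` like `S` at `(s₁, t₁)` and
`(s₂, t₂)`, and agrees with `S` outside the strips over `[s₁, s₂]` and `[t₁, t₂]`. -/
structure IsSwap (S S' : Set (α × β)) (s₁ s₂ : α) (t₁ t₂ : β) : Prop where
  mem_iff : ∀ p, p.1 ∉ Icc s₁ s₂ → p.2 ∉ Icc t₁ t₂ → (p ∈ S' ↔ p ∈ S)
  mem_iff_left : (s₂, t₁) ∈ S' ↔ (s₁, t₁) ∈ S
  mem_iff_right : (s₁, t₂) ∈ S' ↔ (s₂, t₂) ∈ S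

theorem IsCutSplitting.isSplitBy_cons {S S' : Set (α × β)} {l : List ((α × β) × (α × β))}
    {l₁ l₂ l₃ l₄ s₁ s₂ : α} {j₀ j₁ t₁ t₂ : β} (h : IsCutSplitting S l l₁ l₂ l₃ l₄ j₀ j₁)
    (hswap : IsSwap S S' s₁ s₂ t₁ t₂) (hs : l₁ < s₁ ∧ s₂ < l₄) (ht : j₀ < t₁ ∧ t₂ < j₁)
    {p q : α × β} (hp : p ∈ Ioo l₁ l₄ ×ˢ Ioo j₀ j₁) (hq : q ∈ Ioo l₁ l₄ ×ˢ Ioo j₀ j₁)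
    (hpS : p ∈ S') (hqS : q ∉ S') : IsSplitBy S' ((p, q) :: l) := by
  refine IsSplitBy.cons ⟨h.isSplitBy.1, fun P hP => ?_⟩ ⟨hpS, hqS⟩ fun P hP =>
    ⟨sepIntervals_of_mem_Ioo hp.1 hq.1 (h.onOneSide P hP).1,
      sepIntervals_of_mem_Ioo hp.2 hq.2 (h.onOneSide P hP).2⟩
  have hout := h.onOneSide P hP
  simp only [OnOneSide, max_le_iff, le_min_iff] at hout
  rw [hswap.mem_iff P.1 (by grind) (by grind), hswap.mem_iff P.2 (by grind) (by grind)]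
  exact h.isSplitBy.2 P hP

/-- The new pair lies above the box, and the new cut between the box and the right half of the old
cut. -/
theorem IsCutSplitting.exists_cons_of_box_subset [DenselyOrdered α] [DenselyOrdered β]
    {S S' : Set (α × β)} {l : List ((α × β) × (α × β))} {l₁ l₂ l₃ l₄ s₁ s₂ a b : α}
    {j₀ j₁ t₁ t₂ c e : β} (h : IsCutSplitting S l l₁ l₂ l₃ l₄ j₀ j₁)
    (hswap : IsSwap S S' s₁ s₂ t₁ t₂) (hs₁ : s₁ ∈ Ioo l₁ l₂) (hs₂ : s₂ ∈ Ioo l₃ l₄)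
    (ht : j₀ < t₁ ∧ t₁ < t₂ ∧ t₂ < j₁) (hab : s₁ ≤ a ∧ a < b ∧ b ≤ s₂)
    (hce : j₀ ≤ c ∧ c < e ∧ e < t₁) (hbox : ∀ p ∈ Ioo a b ×ˢ Ioo c e, p ∈ S') :
    ∃ P, IsCutSplitting S' (P :: l) a b s₂ l₄ c e := by
  obtain ⟨s, hs⟩ := exists_between hs₁.1
  obtain ⟨t, ht'⟩ := exists_between ht.2.2
  have := h.le_middle
  have hst : (s, t) ∈ S' :=
    (hswap.mem_iff _ (by grind) (by grind)).2 (h.mem _ (by simp only [mem_prod]; grind))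
  have hst' : (s₁, t₂) ∉ S' :=
    hswap.mem_iff_right.not.2 (h.notMem _ (by simp only [mem_prod]; grind))
  refine ⟨((s, t), (s₁, t₂)), ⟨hab.2.1, hab.2.2, hs₂.2, hce.2.1, hbox, fun p hp => ?_⟩,
    h.isSplitBy_cons hswap (by grind) (by grind) ?_ ?_ hst hst',
    List.forall_mem_cons.2 ⟨?_, fun P hP => ?_⟩⟩
  · simp only [mem_prod] at hp
    rw [hswap.mem_iff p (by grind) (by grind)]
    exact h.notMem p (by simp only [mem_prod]; grind)
  · simp only [mem_prod]; grind
  · simp only [mem_prod]; grind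
  · simp only [OnOneSide, max_le_iff, le_min_iff]; grind
  · have hout := h.onOneSide P hP
    simp only [OnOneSide, max_le_iff, le_min_iff] at *
    grind

/-- The new pair lies above the box, and the new cut between the left half of the old cut and the
box. -/
theorem IsCutSplitting.exists_cons_of_box_disjoint [DenselyOrdered α] [DenselyOrdered β]
    {S S' : Set (α × β)} {l : List ((α × β) × (α × β))} {l₁ l₂ l₃ l₄ s₁ s₂ a b : α}
    {j₀ j₁ t₁ t₂ c e : β} (h : IsCutSplitting S l l₁ l₂ l₃ l₄ j₀ j₁)
    (hswap : IsSwap S S' s₁ s₂ t₁ t₂) (hs₁ : s₁ ∈ Ioo l₁ l₂) (hs₂ : s₂ ∈ Ioo l₃ l₄)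
    (ht : j₀ < t₁ ∧ t₁ < t₂ ∧ t₂ < j₁) (hab : s₁ ≤ a ∧ a < b ∧ b ≤ s₂)
    (hce : j₀ ≤ c ∧ c < e ∧ e < t₁) (hbox : ∀ p ∈ Ioo a b ×ˢ Ioo c e, p ∉ S') :
    ∃ P, IsCutSplitting S' (P :: l) l₁ s₁ a b c e := by
  obtain ⟨s, hs⟩ := exists_between hs₂.2
  obtain ⟨t, ht'⟩ := exists_between hce.2.2
  have := h.le_middle
  have hst : (s, t) ∉ S' :=
    (hswap.mem_iff _ (by grind) (by grind)).not.2 (h.notMem _ (by simp only [mem_prod]; grind))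
  have hst' : (s₂, t₁) ∈ S' :=
    hswap.mem_iff_left.2 (h.mem _ (by simp only [mem_prod]; grind))
  refine ⟨((s₂, t₁), (s, t)), ⟨hs₁.1, hab.1, hab.2.1, hce.2.1, fun p hp => ?_, hbox⟩,
    h.isSplitBy_cons hswap (by grind) (by grind) ?_ ?_ hst' hst,
    List.forall_mem_cons.2 ⟨?_, fun P hP => ?_⟩⟩
  · simp only [mem_prod] at hp
    rw [hswap.mem_iff p (by grind) (by grind)]
    exact h.mem p (by simp only [mem_prod]; grind)
  · simp only [mem_prod]; grind
  · simp only [mem_prod]; grind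
  · simp only [OnOneSide, max_le_iff, le_min_iff]; grind
  · have hout := h.onOneSide P hP
    simp only [OnOneSide, max_le_iff, le_min_iff] at *
    grind

/-- A family `𝒯` whose members split only short lists is impossible: after a swap inside the box of
a cut, the new set is constant on a small box below the swapped points, and this box replaces one
half of the cut while the swapped points and their neighbours yield one more split pair. -/
theorem exists_isSplitBy_of_forall_exists_isSwap [DenselyOrdered α] [DenselyOrdered β]
    {𝒯 : Set (Set (α × β))} (hswap : ∀ S ∈ 𝒯, ∀ s₁ s₂ t₁ t₂, s₁ < s₂ → t₁ < t₂ →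
      ∃ S' ∈ 𝒯, IsSwap S S' s₁ s₂ t₁ t₂)
    (hcut : ∃ S ∈ 𝒯, ∃ l₁ l₂ l₃ l₄ j₀ j₁, IsCut S l₁ l₂ l₃ l₄ j₀ j₁) (k : ℕ) :
    ∃ S ∈ 𝒯, ∃ l, IsSplitBy S l ∧ l.length = k := by
  by_contra! hsplit
  suffices ∀ n : ℕ, ∃ S ∈ 𝒯, ∃ l : List ((α × β) × (α × β)), l.length = n ∧
      ∃ l₁ l₂ l₃ l₄ j₀ j₁, IsCutSplitting S l l₁ l₂ l₃ l₄ j₀ j₁ by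
    obtain ⟨S, hS, l, hk, _, _, _, _, _, _, h⟩ := this k
    exact hsplit S hS l h.isSplitBy hk
  intro n
  induction n with
  | zero =>
    obtain ⟨S, hS, l₁, l₂, l₃, l₄, j₀, j₁, h⟩ := hcut
    exact ⟨S, hS, [], rfl, l₁, l₂, l₃, l₄, j₀, j₁, h, isSplitBy_nil S, by simp⟩
  | succ n ih =>
    obtain ⟨S, hS, l, rfl, l₁, l₂, l₃, l₄, j₀, j₁, h⟩ := ih
    obtain ⟨s₁, hs₁⟩ := exists_between h.lt_left
    obtain ⟨s₂, hs₂⟩ := exists_between h.lt_right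
    obtain ⟨t₀, ht₀, ht₀'⟩ := exists_between h.lt_height
    obtain ⟨t₁, ht₁, ht₁'⟩ := exists_between ht₀'
    obtain ⟨t₂, ht₂, ht₂'⟩ := exists_between ht₁'
    have hs : s₁ < s₂ := hs₁.2.trans (h.le_middle.trans_lt hs₂.1)
    obtain ⟨S', hS', hSS'⟩ := hswap S hS s₁ s₂ t₁ t₂ hs ht₂
    obtain ⟨a, b, c, e, ha, hab, hb, hc, hce, he, hbox | hbox⟩ :=
      exists_constant_subbox (hsplit S' hS') hs ht₀
    · obtain ⟨P, hP⟩ := h.exists_cons_of_box_subset hSS' hs₁ hs₂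
        ⟨ht₀.trans ht₁, ht₂, ht₂'⟩ ⟨ha, hab, hb⟩ ⟨hc, hce, he.trans_lt ht₁⟩ hbox
      exact ⟨S', hS', P :: l, rfl, _, _, _, _, _, _, hP⟩
    · obtain ⟨P, hP⟩ := h.exists_cons_of_box_disjoint hSS' hs₁ hs₂
        ⟨ht₀.trans ht₁, ht₂, ht₂'⟩ ⟨ha, hab, hb⟩ ⟨hc, hce, he.trans_lt ht₁⟩ hbox
      exact ⟨S', hS', P :: l, rfl, _, _, _, _, _, _, hP⟩

end PlanarSplittings

section IteratedHyperfilter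

open Filter

/-- The `n`-fold tensor power of the hyperfilter on `ℕ`, with the first coordinate chosen first. A
large set contains `x` with `x 0 < x 1 < ⋯`, each coordinate being large compared to the previous
ones. -/
noncomputable def iteratedHyperfilter : (n : ℕ) → Ultrafilter (Fin n → ℕ)
  | 0 => pure finZeroElim
  | n + 1 => (hyperfilter ℕ).bind fun j => (iteratedHyperfilter n).map (Fin.cons j)

theorem eventually_iteratedHyperfilter_succ {n : ℕ} {P : (Fin (n + 1) → ℕ) → Prop} :
    (∀ᶠ x in iteratedHyperfilter (n + 1), P x) ↔
      ∀ᶠ j in hyperfilter ℕ, ∀ᶠ x in iteratedHyperfilter n, P (Fin.cons j x) :=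
  Iff.rfl

theorem cons_apply_of_ne_zero {n : ℕ} (j : ℕ) (x : Fin n → ℕ) {i : Fin (n + 1)} (hi : i ≠ 0) :
    (Fin.cons j x : Fin (n + 1) → ℕ) i = x (i.pred hi) := by
  conv_lhs => rw [← Fin.succ_pred i hi, Fin.cons_succ]

theorem eventually_iteratedHyperfilter_comp {k n : ℕ} {f : Fin k → Fin n} (hf : StrictMono f)
    (P : (Fin k → ℕ) → Prop) :
    (∀ᶠ x in iteratedHyperfilter n, P (x ∘ f)) ↔ ∀ᶠ x in iteratedHyperfilter k, P x := by
  induction n generalizing k with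
  | zero =>
    obtain rfl : k = 0 := by
      by_contra hk
      exact (f ⟨0, Nat.pos_of_ne_zero hk⟩).elim0
    exact eventually_congr (.of_forall fun x => by rw [Subsingleton.elim (x ∘ f) x])
  | succ n ih =>
    rw [eventually_iteratedHyperfilter_succ]
    by_cases h0 : ∃ i, f i = 0
    · obtain ⟨i, hi⟩ := h0
      cases k with
      | zero => exact i.elim0
      | succ k =>
        have hf0 : f 0 = 0 := Fin.le_zero_iff.1 (hi ▸ hf.monotone (Fin.zero_le i))
        have hne (i : Fin k) : f i.succ ≠ 0 := hf0 ▸ (hf i.succ_pos).ne'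
        have hcons (j : ℕ) (x : Fin n → ℕ) : (Fin.cons j x : Fin (n + 1) → ℕ) ∘ f =
            Fin.cons j (x ∘ fun i : Fin k => (f i.succ).pred (hne i)) := by
          refine funext (Fin.cases ?_ fun i => ?_)
          · simp [hf0]
          · simp [cons_apply_of_ne_zero j x (hne i)]
        simp only [hcons, eventually_iteratedHyperfilter_succ]
        refine eventually_congr (.of_forall fun j => ih (f := fun i => (f i.succ).pred (hne i))
          (fun _ _ h => ?_) fun x => P (Fin.cons j x))
        exact Fin.pred_lt_pred_iff.2 (hf (Fin.succ_lt_succ_iff.2 h))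
    · push Not at h0
      have hcons (j : ℕ) (x : Fin n → ℕ) : (Fin.cons j x : Fin (n + 1) → ℕ) ∘ f =
          x ∘ fun i => (f i).pred (h0 i) :=
        funext fun i => cons_apply_of_ne_zero j x (h0 i)
      simp only [hcons, ih (f := fun i => (f i).pred (h0 i))
        fun _ _ h => Fin.pred_lt_pred_iff.2 (hf h), eventually_const]

theorem map_comp_iteratedHyperfilter {k n : ℕ} {f : Fin k → Fin n} (hf : StrictMono f) :
    (iteratedHyperfilter n).map (· ∘ f) = iteratedHyperfilter k :=
  Ultrafilter.ext fun s => eventually_iteratedHyperfilter_comp hf (· ∈ s)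

theorem eventually_iteratedHyperfilter_two_lt :
    ∀ᶠ x : Fin 2 → ℕ in iteratedHyperfilter 2, x 0 < x 1 := by
  have hgt (j : ℕ) : ∀ᶠ k in hyperfilter ℕ, j < k :=
    Nat.hyperfilter_le_atTop (eventually_gt_atTop j)
  exact eventually_iteratedHyperfilter_succ.2 <| .of_forall fun j =>
    eventually_iteratedHyperfilter_succ.2 <| (hgt j).mono fun k hk => .of_forall fun _ => hk

variable (Q : Type*) [LinearOrder Q]

/-- The filter of functions `Q → ℕ` whose restrictions to the finite subsets of `Q` are generic for
the powers of the hyperfilter. -/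
noncomputable def iteratedHyperfilterOn : Filter (Q → ℕ) :=
  ⨅ f : Σ n, Fin n ↪o Q, comap (· ∘ f.2) (iteratedHyperfilter f.1 : Filter (Fin f.1 → ℕ))

variable {Q}

theorem comap_iteratedHyperfilter_mono {k n : ℕ} {f : Fin k ↪o Q} {g : Fin n ↪o Q}
    (hfg : Set.range f ⊆ Set.range g) :
    comap (· ∘ g) (iteratedHyperfilter n : Filter (Fin n → ℕ)) ≤
      comap (· ∘ f) (iteratedHyperfilter k : Filter (Fin k → ℕ)) := by
  choose e he using fun i => hfg (Set.mem_range_self i)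
  have hmono : StrictMono e := fun i i' h => by rwa [← g.lt_iff_lt, he, he, f.lt_iff_lt]
  have hfge : f = g ∘ e := funext fun i => (he i).symm
  rw [← map_le_iff_le_comap, hfge, ← map_comp_iteratedHyperfilter hmono]
  exact (map_map (m := (· ∘ g)) (m' := (· ∘ e))).symm.trans_le (map_mono map_comap_le)

instance iteratedHyperfilterOn_neBot : (iteratedHyperfilterOn Q).NeBot := by
  refine iInf_neBot_of_directed ?_ fun f =>
    (iteratedHyperfilter f.1).neBot.comap_of_surj f.2.injective.surjective_comp_right
  intro f g
  let s : Finset Q := Finset.univ.image f.2 ∪ Finset.univ.image g.2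
  refine ⟨⟨s.card, s.orderEmbOfFin rfl⟩, comap_iteratedHyperfilter_mono ?_,
    comap_iteratedHyperfilter_mono ?_⟩ <;> simp [s]

theorem map_comp_iteratedHyperfilterOn {n : ℕ} (f : Fin n ↪o Q) :
    (iteratedHyperfilterOn Q).map (· ∘ f) = iteratedHyperfilter n :=
  Ultrafilter.unique _ (map_le_iff_le_comap.2 (iInf_le _ (⟨n, f⟩ : Σ n, Fin n ↪o Q)))

theorem eventually_comp_iteratedHyperfilterOn {n : ℕ} (f : Fin n ↪o Q) (P : (Fin n → ℕ) → Prop) :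
    (∀ᶠ h in iteratedHyperfilterOn Q, P (h ∘ f)) ↔ ∀ᶠ x in iteratedHyperfilter n, P x := by
  rw [← map_comp_iteratedHyperfilterOn f, eventually_map]

theorem eventually_lt_of_lt {q q' : Q} (h : q < q') :
    ∀ᶠ x in iteratedHyperfilterOn Q, x q < x q' :=
  (eventually_comp_iteratedHyperfilterOn (OrderEmbedding.ofStrictMono ![q, q'] (by simp [h])) _).2
    eventually_iteratedHyperfilter_two_lt

theorem exists_common_orderEmbedding {J : Type*} [Finite J] {p q : J → Q}
    (hpq : ∀ x y, p x < p y ↔ q x < q y) :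
    ∃ (n : ℕ) (f g : Fin n ↪o Q) (c : J → Fin n), f ∘ c = p ∧ g ∘ c = q := by
  cases nonempty_fintype J
  let s : Finset Q := Finset.univ.image p
  let f : Fin s.card ↪o Q := s.orderEmbOfFin rfl
  have hrange : Set.range f = Set.range p := by simp [f, s]
  choose c hc using fun x => hrange.ge (Set.mem_range_self x)
  choose r hr using fun i => hrange.le (Set.mem_range_self i)
  have hmono : StrictMono (q ∘ r) := fun i i' h => (hpq _ _).1 (by rwa [hr, hr, f.lt_iff_lt])
  have heq {x y} (h : p x = p y) : q x = q y :=
    le_antisymm (not_lt.1 fun hlt => ((hpq _ _).2 hlt).ne' h)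
      (not_lt.1 fun hlt => ((hpq _ _).2 hlt).ne h)
  exact ⟨_, f, .ofStrictMono _ hmono, c, funext hc, funext fun x => heq ((hr _).trans (hc x))⟩

end IteratedHyperfilter

section IndiscernibleGrid

variable {M : Type w} {ι δ J : Type*}

/-- The tuples `u` and `v` of points of `ℚ^ι` have the same order type in each coordinate. -/
def SamePattern (u v : J → ι → ℚ) : Prop :=
  ∀ i j k, u j i < u k i ↔ v j i < v k i

/-- The array `b` of tuples indexed by `ℚ^ι` is indiscernible over `B`: the type over `B` of
finitely many of its members depends only on the order type of their indices in each coordinate. -/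
def IsIndiscernibleGrid (L : FirstOrder.Language.{u, v}) [L.Structure M] (B : Set M)
    (b : (ι → ℚ) → δ → M) : Prop :=
  ∀ (J : Type) [Finite J] (u v : J → ι → ℚ), SamePattern u v → ∀ R : Set (J × δ → M),
    B.Definable L R → ((fun y => b (u y.1) y.2) ∈ R ↔ (fun y => b (v y.1) y.2) ∈ R)

/-- The array `b` indexed by `ℚ^ι` realizes the Ehrenfeucht–Mostowski type over `B` of the array `a`
indexed by `ℕ^ι`. -/
def RealizesEMType (L : FirstOrder.Language.{u, v}) [L.Structure M] (B : Set M)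
    (a : (ι → ℕ) → δ → M) (b : (ι → ℚ) → δ → M) : Prop :=
  ∀ (J : Type) [Finite J] (u : J → ι → ℚ) (R : Set (J × δ → M)), B.Definable L R →
    (∀ g : J → ι → ℕ, (∀ i j k, u j i < u k i → g j i < g k i) →
      (fun y => a (g y.1) y.2) ∈ R) → (fun y => b (u y.1) y.2) ∈ R

/-- The point of `ℕ^ι` obtained from a point of `ℚ^ι` by applying `h` to its coordinates, each
labelled by its axis. -/
def evalPoint (h : ι ×ₗ ℚ → ℕ) (g : ι → ℚ) : ι → ℕ :=
  fun i => h (toLex (i, g i))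

/-- The coordinates of the members of a tuple of points, each labelled by its axis. -/
def labelledCoord (u : J → ι → ℚ) (x : J × ι) : ι ×ₗ ℚ :=
  toLex (x.2, u x.1 x.2)

theorem SamePattern.labelledCoord_lt_iff [LinearOrder ι] {u v : J → ι → ℚ} (h : SamePattern u v)
    (x y : J × ι) : labelledCoord u x < labelledCoord u y ↔
      labelledCoord v x < labelledCoord v y := by
  simp only [labelledCoord, Prod.Lex.toLex_lt_toLex]
  refine or_congr_right (and_congr_right fun hxy => ?_)
  rw [← hxy]
  exact h _ _ _

theorem evalPoint_eq_of_labelledCoord {n : ℕ} {u : J → ι → ℚ} {f : Fin n → ι ×ₗ ℚ}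
    {c : J × ι → Fin n} (hf : f ∘ c = labelledCoord u) (h : ι ×ₗ ℚ → ℕ) (j : J) :
    evalPoint h (u j) = fun i => (h ∘ f) (c (j, i)) :=
  funext fun i => congrArg h (congrFun hf (j, i)).symm

variable [Finite ι] [LinearOrder ι] [Finite J]

theorem eventually_evalPoint_congr (a : (ι → ℕ) → δ → M) {u v : J → ι → ℚ}
    (huv : SamePattern u v) (R : Set (J × δ → M)) :
    (∀ᶠ h in iteratedHyperfilterOn (ι ×ₗ ℚ), (fun y => a (evalPoint h (u y.1)) y.2) ∈ R) ↔
      ∀ᶠ h in iteratedHyperfilterOn (ι ×ₗ ℚ), (fun y => a (evalPoint h (v y.1)) y.2) ∈ R := by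
  obtain ⟨n, f, g, c, hf, hg⟩ := exists_common_orderEmbedding huv.labelledCoord_lt_iff
  simp only [evalPoint_eq_of_labelledCoord hf, evalPoint_eq_of_labelledCoord hg]
  let P : (Fin n → ℕ) → Prop := fun x => (fun y => a (fun i => x (c (y.1, i))) y.2) ∈ R
  exact (eventually_comp_iteratedHyperfilterOn f P).trans
    (eventually_comp_iteratedHyperfilterOn g P).symm

theorem eventually_evalPoint_notMem (a : (ι → ℕ) → δ → M) (u : J → ι → ℚ) (R : Set (J × δ → M)) :
    (∀ᶠ h in iteratedHyperfilterOn (ι ×ₗ ℚ), (fun y => a (evalPoint h (u y.1)) y.2) ∉ R) ↔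
      ¬ ∀ᶠ h in iteratedHyperfilterOn (ι ×ₗ ℚ), (fun y => a (evalPoint h (u y.1)) y.2) ∈ R := by
  obtain ⟨n, f, -, c, hf, -⟩ := exists_common_orderEmbedding fun x y =>
    Iff.refl (labelledCoord u x < labelledCoord u y)
  simp only [evalPoint_eq_of_labelledCoord hf]
  let P : (Fin n → ℕ) → Prop := fun x => (fun y => a (fun i => x (c (y.1, i))) y.2) ∈ R
  rw [eventually_comp_iteratedHyperfilterOn f P,
    eventually_comp_iteratedHyperfilterOn f fun x => ¬ P x]
  exact Ultrafilter.eventually_not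

theorem IsSaturated.exists_isIndiscernibleGrid {L : FirstOrder.Language.{u, v}} [L.Structure M]
    {κ : Cardinal.{w}} (hM : IsSaturated L M κ) (hκ : ℵ_ 1 ≤ κ) {B : Set M} (hB : #B < κ)
    [Countable δ] (a : (ι → ℕ) → δ → M) :
    ∃ b : (ι → ℚ) → δ → M, IsIndiscernibleGrid L B b ∧ RealizesEMType L B a b := by
  let ev : (ι ×ₗ ℚ → ℕ) → (ι → ℚ) × δ → M := fun h x => a (evalPoint h x.1) x.2
  obtain ⟨x, hx⟩ := hM.exists_forall_mem hκ hB ((iteratedHyperfilterOn (ι ×ₗ ℚ)).map ev)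
  have htype (J : Type) [Finite J] (u : J → ι → ℚ) (R : Set (J × δ → M)) (hR : B.Definable L R) :
      (fun y => x (u y.1, y.2)) ∈ R ↔
        ∀ᶠ h in iteratedHyperfilterOn (ι ×ₗ ℚ), (fun y => a (evalPoint h (u y.1)) y.2) ∈ R := by
    have hdef := hR.preimage_comp fun y : J × δ => (u y.1, y.2)
    refine ⟨fun hxR => ?_, fun h => hx _ h hdef⟩
    by_contra hR'
    exact hx _ ((eventually_evalPoint_notMem a u R).2 hR') hdef.compl hxR
  refine ⟨fun g q => x (g, q), fun J _ u v huv R hR => ?_, fun J _ u R hR hall => ?_⟩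
  · rw [htype J u R hR, htype J v R hR, eventually_evalPoint_congr a huv]
  · have hlt : ∀ᶠ h in iteratedHyperfilterOn (ι ×ₗ ℚ), ∀ i j k, u j i < u k i →
        evalPoint h (u j) i < evalPoint h (u k) i := by
      simp only [Filter.eventually_all]
      exact fun i j k hjk => eventually_lt_of_lt (Prod.Lex.toLex_lt_toLex.2 (Or.inr ⟨rfl, hjk⟩))
    exact (htype J u R hR).2 (hlt.mono fun h hh => hall (fun j => evalPoint h (u j)) hh)

end IndiscernibleGrid

section Traces

variable {L : FirstOrder.Language.{u, v}} {M : Type w} [L.Structure M] {α β : Type*} [Finite α]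
  [Finite β] {B : Set M} {D : Set (α ⊕ β → M)}

theorem definable_fiber_left (hD : B.Definable L D) {a : α → M} (ha : ∀ i, a i ∈ B) :
    B.Definable L {z | Sum.elim a z ∈ D} :=
  Set.Definable.preimage_map (F := fun z : β → M => Sum.elim a z)
    (Sum.rec (fun i => L.definableFun_const _ (ha i)) fun j => Set.DefinableFun.proj L (i := j)) hD

theorem definable_fiber_right (hD : B.Definable L D) {c : β → M} (hc : ∀ j, c j ∈ B) :
    B.Definable L {x | Sum.elim x c ∈ D} :=
  Set.Definable.preimage_map (F := fun x : α → M => Sum.elim x c)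
    (Sum.rec (fun i => Set.DefinableFun.proj L (i := i)) fun j => L.definableFun_const _ (hc j)) hD

theorem IsSaturated.exists_trace {κ : Cardinal.{w}} (hM : IsSaturated L M κ) (hκ : ℵ_ 1 ≤ κ)
    (hB : #B < κ) (hD : B.Definable L D) {J : Type*} [Countable J] (a : J → α → M) (P : J → Prop)
    (hfin : ∀ T : Finset J, ∃ z, ∀ j ∈ T, Sum.elim (a j) z ∈ D ↔ P j) :
    ∃ z, ∀ j, Sum.elim (a j) z ∈ D ↔ P j := by
  have hC : #(B ∪ Set.range (Function.uncurry a) : Set M) < κ :=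
    mk_union_countable_lt hκ hB (Set.countable_range _)
  obtain ⟨z, hz⟩ := hM.iInter_nonempty hκ hC
    (fun j => definable_iff_mem_iff (definable_fiber_left (hD.mono Set.subset_union_left)
      fun i => Or.inr (Set.mem_range_self (j, i))) (P j))
    fun T => (hfin T).imp fun z hz => Set.mem_iInter₂.2 hz
  exact ⟨z, Set.mem_iInter.1 hz⟩

end Traces

section SignSeparation

variable {M : Type w} {ι δ J : Type*}

/-- `x` and `y` differ in each coordinate, and `σ` tells in which ones `x` is the smaller. -/
def HasSign (σ : ι → Bool) (x y : ι → ℚ) : Prop :=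
  ∀ i, x i ≠ y i ∧ (x i < y i ↔ σ i)

/-- The points `x` and `y` lie in the same open cell of the grid of hyperplanes through the points
`e j`. -/
def SameCell (e : J → ι → ℚ) (x y : ι → ℚ) : Prop :=
  ∀ j i, (e j i < x i ∧ e j i < y i) ∨ (x i < e j i ∧ y i < e j i)

/-- The members of the array `b` at `x`, `y` and the points `e j`, as one tuple. -/
def pairWith (b : (ι → ℚ) → δ → M) (e : J → ι → ℚ) (x y : ι → ℚ) : (Fin 2 ⊕ J) × δ → M :=
  fun q => b (Sum.elim ![x, y] e q.1) q.2

theorem samePattern_sub (u : J → ι → ℚ) (c : ι → ℚ) : SamePattern u fun j => u j - c :=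
  fun i j k => by simp

theorem samePattern_pair {e : J → ι → ℚ} {σ : ι → Bool} {x y x' y' : ι → ℚ}
    (h : HasSign σ x y) (h' : HasSign σ x' y') (hx : SameCell e x x') (hy : SameCell e y y') :
    SamePattern (Sum.elim ![x, y] e) (Sum.elim ![x', y'] e) := by
  intro i j k
  have hi := h i
  have hi' := h' i
  rcases j with j | j <;> rcases k with k | k
  · fin_cases j <;> fin_cases k <;> simp <;> grind
  · have hxi := hx k i
    have hyi := hy k i
    fin_cases j <;> simp <;> grind
  · have hxi := hx j i
    have hyi := hy j i
    fin_cases k <;> simp <;> grind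
  · exact Iff.rfl

theorem SameCell.sub {e : J → ι → ℚ} {x y z : ι → ℚ} (hxy : SameCell e x y)
    (hz : SameCell (fun j => e j - x) 0 z) : SameCell (fun j => e j - x) (y - x) z := by
  intro j i
  have := hxy j i
  have := hz j i
  simp only [Pi.sub_apply, Pi.zero_apply] at *
  grind

/-- Some relation over `B` and finitely many members of the array distinguishes the pairs of sign
`σ` near the origin from those of sign `τ`. -/
def SeparatesSigns (L : FirstOrder.Language.{u, v}) [L.Structure M] (B : Set M)
    (b : (ι → ℚ) → δ → M) (σ τ : ι → Bool) : Prop :=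
  ∃ (J : Type) (_ : Finite J) (e : J → ι → ℚ) (R : Set ((Fin 2 ⊕ J) × δ → M)),
    SameCell e 0 0 ∧ B.Definable L R ∧
    (∀ x y, SameCell e 0 x → SameCell e 0 y → HasSign σ x y → pairWith b e x y ∈ R) ∧
    ∀ x y, SameCell e 0 x → SameCell e 0 y → HasSign τ x y → pairWith b e x y ∉ R

variable {L : FirstOrder.Language.{u, v}} [L.Structure M] {B : Set M} {b : (ι → ℚ) → δ → M}
  {σ τ : ι → Bool}

theorem IsIndiscernibleGrid.separatesSigns (hb : IsIndiscernibleGrid L B b) {J : Type} [Finite J]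
    {e : J → ι → ℚ} {x y x' y' : ι → ℚ} (h : HasSign σ x y) (h' : HasSign τ x' y')
    (hy : SameCell e x y) (hx' : SameCell e x x') (hy' : SameCell e x y')
    {R : Set ((Fin 2 ⊕ J) × δ → M)} (hR : B.Definable L R) (hmem : pairWith b e x y ∈ R)
    (hnotMem : pairWith b e x' y' ∉ R) : SeparatesSigns L B b σ τ := by
  -- Translate the common cell so that it contains the origin.
  have hpattern {ρ : ι → Bool} {p q p' q' : ι → ℚ} (hpq : HasSign ρ p q) (hpq' : HasSign ρ p' q')
      (hp : SameCell e x p) (hq : SameCell e x q) (hp' : SameCell (fun j => e j - x) 0 p')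
      (hq' : SameCell (fun j => e j - x) 0 q') :
      pairWith b e p q ∈ R ↔ pairWith b (fun j => e j - x) p' q' ∈ R := by
    have htranslate : SamePattern (Sum.elim ![p, q] e)
        (Sum.elim ![p - x, q - x] fun j => e j - x) := by
      convert samePattern_sub (Sum.elim ![p, q] e) x using 1
      ext (j | j) <;> [fin_cases j; skip] <;> rfl
    have hcells := samePattern_pair (fun i => by simpa using hpq i) hpq' (hp.sub hp') (hq.sub hq')
    exact hb _ _ _ (fun i j k => (htranslate i j k).trans (hcells i j k)) R hR
  have hx : SameCell e x x := fun j i => (hy j i).imp (fun h => ⟨h.1, h.1⟩) fun h => ⟨h.1, h.1⟩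
  exact ⟨J, ‹_›, fun j => e j - x, R, fun j i => by simpa using hx j i, hR,
    fun p q hp hq hpq => (hpattern h hpq hx hy hp hq).1 hmem,
    fun p q hp hq hpq hpqR => hnotMem ((hpattern h' hpq hx' hy' hp hq).2 hpqR)⟩

end SignSeparation

section PlaneThroughGrid

variable {L : FirstOrder.Language.{u, v}} {M : Type w} [L.Structure M] {ι δ γ : Type*} {B : Set M}
  {b : (ι → ℚ) → δ → M} {σ τ : ι → Bool}

/-- The point of `ℚ^ι` with coordinates `± p.1` along the axes where `σ` and `τ` differ and `± p.2`
along the other ones, the signs being given by `σ`. Then the diagonal of a box of the plane has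
sign `σ` and its antidiagonal has sign `τ`. -/
def planePoint (σ τ : ι → Bool) (p : ℚ × ℚ) : ι → ℚ := fun i =>
  if σ i then (if τ i then p.2 else p.1) else (if τ i then -p.1 else -p.2)

theorem samePattern_planePoint {J : Type*} {p q : J → ℚ × ℚ}
    (hfst : ∀ j k, (p j).1 < (p k).1 ↔ (q j).1 < (q k).1)
    (hsnd : ∀ j k, (p j).2 < (p k).2 ↔ (q j).2 < (q k).2) :
    SamePattern (planePoint σ τ ∘ p) (planePoint σ τ ∘ q) := by
  intro i j k
  simp only [Function.comp_apply, planePoint]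
  split_ifs <;> simp only [neg_lt_neg_iff, hfst, hsnd]

theorem hasSign_planePoint_diagonal {s₁ s₂ t₁ t₂ : ℚ} (hs : s₁ < s₂) (ht : t₁ < t₂) :
    HasSign σ (planePoint σ τ (s₁, t₁)) (planePoint σ τ (s₂, t₂)) := by
  intro i
  simp only [planePoint]
  grind

theorem hasSign_planePoint_antidiagonal {s₁ s₂ t₁ t₂ : ℚ} (hs : s₁ < s₂) (ht : t₁ < t₂) :
    HasSign τ (planePoint σ τ (s₂, t₁)) (planePoint σ τ (s₁, t₂)) := by
  intro i
  simp only [planePoint]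
  grind

theorem sameCell_planePoint {J : Type*} {s₁ s₂ t₁ t₂ : ℚ} {e : J → ℚ × ℚ}
    (he : ∀ j, (e j).1 ∉ Set.Icc s₁ s₂ ∧ (e j).2 ∉ Set.Icc t₁ t₂) {p q : ℚ × ℚ}
    (hp : p ∈ Set.Icc s₁ s₂ ×ˢ Set.Icc t₁ t₂) (hq : q ∈ Set.Icc s₁ s₂ ×ˢ Set.Icc t₁ t₂) :
    SameCell (planePoint σ τ ∘ e) (planePoint σ τ p) (planePoint σ τ q) := by
  intro j i
  have := he j
  simp only [Set.mem_Icc, Set.mem_prod, Function.comp_apply, planePoint] at *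
  grind

/-- The points of the plane `planePoint σ τ` at which the array `b` is `D`-related to `z`. -/
def planeTrace (b : (ι → ℚ) → δ → M) (σ τ : ι → Bool) (D : Set (δ ⊕ γ → M)) (z : γ → M) :
    Set (ℚ × ℚ) :=
  {p | Sum.elim (b (planePoint σ τ p)) z ∈ D}

theorem IsIndiscernibleGrid.exists_swap_of_finite [Finite γ] (hb : IsIndiscernibleGrid L B b)
    (hns : ¬ SeparatesSigns L B b σ τ) {D : Set (δ ⊕ γ → M)} (hD : B.Definable L D) (z : γ → M)
    {s₁ s₂ t₁ t₂ : ℚ} (hs : s₁ < s₂) (ht : t₁ < t₂) {J : Type} [Finite J] {e : J → ℚ × ℚ}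
    (he : ∀ j, (e j).1 ∉ Set.Icc s₁ s₂ ∧ (e j).2 ∉ Set.Icc t₁ t₂) :
    ∃ z', ((s₂, t₁) ∈ planeTrace b σ τ D z' ↔ (s₁, t₁) ∈ planeTrace b σ τ D z) ∧
      ((s₁, t₂) ∈ planeTrace b σ τ D z' ↔ (s₂, t₂) ∈ planeTrace b σ τ D z) ∧
      ∀ j, e j ∈ planeTrace b σ τ D z' ↔ e j ∈ planeTrace b σ τ D z := by
  let pattern : Fin 2 ⊕ J → Prop :=
    fun j => Sum.elim ![(s₁, t₁), (s₂, t₂)] e j ∈ planeTrace b σ τ D z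
  let R : Set ((Fin 2 ⊕ J) × δ → M) :=
    {x | ∃ z' : γ → M, ∀ j, Sum.elim (fun q => x (j, q)) z' ∈ D ↔ pattern j}
  have hmem_iff (p q : ℚ × ℚ) :
      pairWith b (planePoint σ τ ∘ e) (planePoint σ τ p) (planePoint σ τ q) ∈ R ↔
        ∃ z', ∀ j, Sum.elim ![p, q] e j ∈ planeTrace b σ τ D z' ↔ pattern j := by
    refine exists_congr fun z' => forall_congr' fun j => ?_
    rcases j with j | j <;> [fin_cases j; skip] <;> rfl
  have hswap : pairWith b (planePoint σ τ ∘ e) (planePoint σ τ (s₂, t₁))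
      (planePoint σ τ (s₁, t₂)) ∈ R := by
    by_contra hnotMem
    have hcell {p} := sameCell_planePoint (σ := σ) (τ := τ) he (p := (s₁, t₁)) (q := p)
      (by simp [hs.le, ht.le])
    exact hns (hb.separatesSigns (hasSign_planePoint_diagonal hs ht)
      (hasSign_planePoint_antidiagonal hs ht) (hcell (by simp [hs.le, ht.le]))
      (hcell (by simp [hs.le, ht.le])) (hcell (by simp [hs.le, ht.le]))
      (definable_exists_pattern hD pattern) ((hmem_iff _ _).2 ⟨z, fun _ => Iff.rfl⟩) hnotMem)
  obtain ⟨z', hz'⟩ := (hmem_iff _ _).1 hswap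
  exact ⟨z', hz' (Sum.inl 0), hz' (Sum.inl 1), fun j => hz' (Sum.inr j)⟩

theorem IsIndiscernibleGrid.exists_isSwap [Finite δ] [Finite γ] {κ : Cardinal.{w}}
    (hb : IsIndiscernibleGrid L B b) (hM : IsSaturated L M κ) (hκ : ℵ_ 1 ≤ κ) (hB : #B < κ)
    (hns : ¬ SeparatesSigns L B b σ τ) {D : Set (δ ⊕ γ → M)} (hD : B.Definable L D) (z : γ → M)
    {s₁ s₂ t₁ t₂ : ℚ} (hs : s₁ < s₂) (ht : t₁ < t₂) :
    ∃ z', IsSwap (planeTrace b σ τ D z) (planeTrace b σ τ D z') s₁ s₂ t₁ t₂ := by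
  let Off : Type := {p : ℚ × ℚ // p.1 ∉ Set.Icc s₁ s₂ ∧ p.2 ∉ Set.Icc t₁ t₂}
  let old : Fin 2 ⊕ Off → ℚ × ℚ := Sum.elim ![(s₁, t₁), (s₂, t₂)] Subtype.val
  let new : Fin 2 ⊕ Off → ℚ × ℚ := Sum.elim ![(s₂, t₁), (s₁, t₂)] Subtype.val
  obtain ⟨z', hz'⟩ := hM.exists_trace hκ hB hD (fun j => b (planePoint σ τ (new j)))
    (fun j => old j ∈ planeTrace b σ τ D z) fun T => by
      obtain ⟨z', h₀, h₁, hoff⟩ := hb.exists_swap_of_finite hns hD z hs ht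
        (e := fun p : T.toRight => p.1.1) fun p => p.1.2
      refine ⟨z', ?_⟩
      rintro (j | p) hj
      · fin_cases j
        exacts [h₀, h₁]
      · exact hoff ⟨p, Finset.mem_toRight.2 hj⟩
  exact ⟨z', fun p h₁ h₂ => hz' (Sum.inr ⟨p, h₁, h₂⟩), hz' (Sum.inl 0), hz' (Sum.inl 1)⟩

theorem IsIndiscernibleGrid.not_hasFiniteVCDim [Finite γ] (hb : IsIndiscernibleGrid L B b)
    {D : Set (δ ⊕ γ → M)} (hD : B.Definable L D)
    (hsplit : ∀ k, ∃ z l, IsSplitBy (planeTrace b σ τ D z) l ∧ l.length = k) :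
    ¬ HasFiniteVCDim D := by
  classical
  rintro ⟨k, hk⟩
  obtain ⟨z, l, ⟨hsep, hl⟩, rfl⟩ := hsplit k
  refine hk ⟨fun j => b (planePoint σ τ l[j].1), fun s => ?_⟩
  let p : Fin l.length → ℚ × ℚ := fun j => if j ∈ s then l[j].1 else l[j].2
  have hp (j) : p j ∈ planeTrace b σ τ D z ↔ j ∈ s := by
    have := hl l[j] (List.getElem_mem _)
    grind
  have hp' (j) : p j = l[j].1 ∨ p j = l[j].2 := by grind
  have hpattern : ∀ j j', ((p j).1 < (p j').1 ↔ l[j].1.1 < l[j'].1.1) ∧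
      ((p j).2 < (p j').2 ↔ l[j].1.2 < l[j'].1.2) := by
    intro j j'
    rcases lt_trichotomy j j' with h | rfl | h
    · exact (List.pairwise_iff_get.1 hsep j j' h).lt_iff_lt (hp' j) (hp' j')
    · simp only [lt_self_iff_false, and_self]
    · exact (List.pairwise_iff_get.1 hsep j' j h).symm.lt_iff_lt (hp' j) (hp' j')
  exact (hb _ _ _ (samePattern_planePoint (fun j j' => (hpattern j j').1)
    fun j j' => (hpattern j j').2) _ (definable_exists_pattern hD (· ∈ s))).1 ⟨z, hp⟩

end PlaneThroughGrid

section AxisCuts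

variable {M : Type w} {ι δ γ : Type*}

/-- For each hyperplane `x i = ℓ` some instance of `D` holds at the members of the array `b` on the
lower side of it and fails on the upper side. -/
def CutsAxis (D : Set (δ ⊕ γ → M)) (b : (ι → ℚ) → δ → M) (i : ι) : Prop :=
  ∀ ℓ : ℚ, ∃ z, ∀ x : ι → ℚ, x i ≠ ℓ → (Sum.elim (b x) z ∈ D ↔ x i < ℓ)

theorem CutsAxis.separatesSigns {L : FirstOrder.Language.{u, v}} [L.Structure M] [Finite δ]
    [Finite γ] {B : Set M} {b : (ι → ℚ) → δ → M} {D : Set (δ ⊕ γ → M)} {i : ι}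
    (hcut : CutsAxis D b i) {κ : Cardinal.{w}} (hM : IsSaturated L M κ) (hκ : ℵ_ 1 ≤ κ)
    (hB : #B < κ) (hb : IsIndiscernibleGrid L B b) (hD : B.Definable L D)
    (hvc : HasFiniteVCDim D) {σ τ : ι → Bool} (hσ : σ i = true) (hτ : τ i = false) :
    SeparatesSigns L B b σ τ := by
  by_contra hns
  refine hb.not_hasFiniteVCDim (σ := σ) (τ := τ) hD (fun k => ?_) hvc
  obtain ⟨z₀, hz₀⟩ := hcut 0
  have hfst (p) : planePoint σ τ p i = p.1 := by simp [planePoint, hσ, hτ]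
  have htrace (p : ℚ × ℚ) (hp : p.1 ≠ 0) : p ∈ planeTrace b σ τ D z₀ ↔ p.1 < 0 := by
    simpa only [hfst] using! hz₀ (planePoint σ τ p) (by rwa [hfst])
  obtain ⟨_, ⟨z, rfl⟩, hz⟩ := exists_isSplitBy_of_forall_exists_isSwap
    (𝒯 := Set.range (planeTrace b σ τ D))
    (by
      rintro _ ⟨z, rfl⟩ s₁ s₂ t₁ t₂ hs ht
      obtain ⟨z', hz'⟩ := hb.exists_isSwap hM hκ hB hns hD z hs ht
      exact ⟨_, ⟨z', rfl⟩, hz'⟩)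
    ⟨_, ⟨z₀, rfl⟩, -1, 0, 0, 1, 0, 1,
      { lt_left := by norm_num
        le_middle := le_rfl
        lt_right := one_pos
        lt_height := one_pos
        mem := fun p hp => (htrace p hp.1.2.ne).2 hp.1.2
        notMem := fun p hp h => hp.1.1.not_gt ((htrace p hp.1.1.ne').1 h) }⟩ k
  exact ⟨z, hz⟩

end AxisCuts

section OrderFormulas

open scoped Topology

variable {L : FirstOrder.Language.{u, v}} {M : Type w} [L.Structure M] {ι δ : Type*} [Finite ι]
  {B : Set M} {b : (ι → ℚ) → δ → M}

theorem eventually_sameCell {J : Type*} [Finite J] {e : J → ι → ℚ} {x : ι → ℚ}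
    (hx : SameCell e x x) : ∀ᶠ y in 𝓝 x, SameCell e x y := by
  refine Filter.eventually_all.2 fun j => Filter.eventually_all.2 fun i => ?_
  have htendsto : Filter.Tendsto (fun y : ι → ℚ => y i) (𝓝 x) (𝓝 (x i)) :=
    (continuous_apply i).continuousAt
  rcases hx j i with h | h
  · exact (htendsto.eventually_const_lt h.1).mono fun y hy => Or.inl ⟨h.1, hy⟩
  · exact (htendsto.eventually_lt_const h.1).mono fun y hy => Or.inr ⟨h.1, hy⟩

theorem SeparatesSigns.exists_definable [Finite δ] {σ τ : ι → Bool}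
    (h : SeparatesSigns L B b σ τ) :
    ∃ W : Set (Fin 2 × δ → M), (Set.univ : Set M).Definable L W ∧
      ∀ᶠ p in 𝓝 (0 : ι → ℚ) ×ˢ 𝓝 (0 : ι → ℚ),
        (HasSign σ p.1 p.2 → (fun q => b (![p.1, p.2] q.1) q.2) ∈ W) ∧
        (HasSign τ p.1 p.2 → (fun q => b (![p.1, p.2] q.1) q.2) ∉ W) := by
  obtain ⟨J, _, e, R, he, hR, hσ, hτ⟩ := h
  let extend (w : Fin 2 × δ → M) : (Fin 2 ⊕ J) × δ → M :=
    fun q => Sum.elim (fun j => w (j, q.2)) (fun j => b (e j) q.2) q.1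
  have hextend : (Set.univ : Set M).DefinableMap L extend := by
    rintro ⟨j | j, q⟩
    · exact Set.DefinableFun.proj L
    · exact L.definableFun_const _ (Set.mem_univ _)
  have hpair (x y : ι → ℚ) :
      extend (fun q => b (![x, y] q.1) q.2) = pairWith b e x y := by
    ext ⟨j | j, q⟩ <;> rfl
  refine ⟨extend ⁻¹' R, (hR.mono (Set.subset_univ B)).preimage_map hextend, ?_⟩
  filter_upwards [Filter.prod_mem_prod (eventually_sameCell he) (eventually_sameCell he)]
    with p hp
  simp only [Set.mem_preimage, hpair]
  exact ⟨hσ _ _ hp.1 hp.2, hτ _ _ hp.1 hp.2⟩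

theorem exists_definable_lt_of_forall_ne [Finite δ] {i : ι} (hsep : ∀ σ τ : ι → Bool,
      σ i = true → τ i = false → SeparatesSigns L B b σ τ) :
    ∃ W : Set (Fin 2 × δ → M), (Set.univ : Set M).Definable L W ∧
      ∀ᶠ p in 𝓝 (0 : ι → ℚ) ×ˢ 𝓝 (0 : ι → ℚ), (∀ j, p.1 j ≠ p.2 j) →
        ((fun q => b (![p.1, p.2] q.1) q.2) ∈ W ↔ p.1 i < p.2 i) := by
  choose W hW hsep using fun (σ : {σ : ι → Bool // σ i = true})
    (τ : {τ : ι → Bool // τ i = false}) => (hsep σ τ σ.2 τ.2).exists_definable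
  refine ⟨⋃ σ, ⋂ τ, W σ τ, Set.definable_iUnion_of_finite fun σ =>
    Set.definable_iInter_of_finite fun τ => hW σ τ, ?_⟩
  filter_upwards [Filter.eventually_all.2 fun σ => Filter.eventually_all.2 fun τ => hsep σ τ]
    with p hp hne
  let ρ : ι → Bool := fun j => decide (p.1 j < p.2 j)
  have hρ : HasSign ρ p.1 p.2 := fun j => ⟨hne j, decide_eq_true_iff.symm⟩
  simp only [Set.mem_iUnion, Set.mem_iInter]
  refine ⟨fun ⟨σ, hσ⟩ => ?_, fun hlt => ⟨⟨ρ, decide_eq_true hlt⟩, fun τ => (hp _ τ).1 hρ⟩⟩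
  by_contra hlt
  exact (hp σ ⟨ρ, decide_eq_false hlt⟩).2 hρ (hσ _)

theorem exists_definable_lt [Finite δ] {i : ι} (hsep : ∀ σ τ : ι → Bool,
      σ i = true → τ i = false → SeparatesSigns L B b σ τ) :
    ∃ W : Set (Fin 2 × δ → M), (Set.univ : Set M).Definable L W ∧
      ∀ᶠ p in 𝓝 (0 : ι → ℚ) ×ˢ 𝓝 (0 : ι → ℚ), (p.1 = p.2 ∨ ∀ j, p.1 j ≠ p.2 j) →
        ((fun q => b (![p.1, p.2] q.1) q.2) ∈ W ↔ p.1 i < p.2 i) := by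
  obtain ⟨W, hW, hlt⟩ := exists_definable_lt_of_forall_ne hsep
  -- `W x x` is unknown, hence the asymmetric part of `W`.
  let swap (w : Fin 2 × δ → M) : Fin 2 × δ → M := w ∘ Prod.map Fin.rev id
  have hswap (x y : ι → ℚ) :
      swap (fun q => b (![x, y] q.1) q.2) = fun q => b (![y, x] q.1) q.2 := by
    ext ⟨j, q⟩
    fin_cases j <;> rfl
  refine ⟨W ∩ (swap ⁻¹' W)ᶜ, hW.inter (hW.preimage_comp _).compl, ?_⟩
  filter_upwards [hlt, Filter.eventually_swap_iff.1 hlt] with p hp hp' hp₀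
  simp only [Set.mem_inter_iff, Set.mem_compl_iff, Set.mem_preimage, hswap]
  rcases hp₀ with hp₀ | hne
  · simp [hp₀]
  · rw [hp hne]
    exact and_iff_left_of_imp fun h h' => h.not_gt ((hp' fun j => (hne j).symm).1 h')

theorem IsIndiscernibleGrid.exists_nhds_forall_exists_definable_lt [Finite δ]
    {γ : ι → Type*} [∀ i, Finite (γ i)] {κ : Cardinal.{w}}
    (hb : IsIndiscernibleGrid L B b) (hM : IsSaturated L M κ) (hκ : ℵ_ 1 ≤ κ) (hB : #B < κ)
    {D : ∀ i, Set (δ ⊕ γ i → M)} (hD : ∀ i, B.Definable L (D i))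
    (hvc : ∀ i, HasFiniteVCDim (D i)) (hcut : ∀ i, CutsAxis (D i) b i) :
    ∃ U ∈ 𝓝 (0 : ι → ℚ), ∀ i, ∃ W : Set (Fin 2 × δ → M), (Set.univ : Set M).Definable L W ∧
      ∀ x ∈ U, ∀ y ∈ U, (x = y ∨ ∀ j, x j ≠ y j) →
        ((fun q => b (![x, y] q.1) q.2) ∈ W ↔ x i < y i) := by
  choose W hW hlt using fun i => exists_definable_lt fun σ τ hσ hτ =>
    (hcut i).separatesSigns hM hκ hB hb (hD i) (hvc i) hσ hτ
  obtain ⟨U, hU, h⟩ := Filter.mem_prod_self_iff.1 (Filter.eventually_all.2 hlt)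
  exact ⟨U, hU, fun i => ⟨W i, hW i, fun x hx y hy => h (Set.mk_mem_prod hx hy) i⟩⟩

end OrderFormulas

section GridFromPattern

open scoped Topology

variable {L : FirstOrder.Language.{u, v}} {M : Type w} [L.Structure M]

theorem FinitelySatisfiable.realizations_nonempty {α : Type*} [Countable α] {κ : Cardinal.{w}}
    {p : Set (L[[M]].Formula α)} (hp : FinitelySatisfiable M p) (hM : IsSaturated L M κ)
    (hκ : ℵ_ 1 ≤ κ) {C : Set M} (hC : #C < κ)
    (hdef : ∀ ψ ∈ p, C.Definable L {x | ψ.Realize x}) : (realizations M p).Nonempty := by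
  obtain ⟨a, ha⟩ := hM.iInter_nonempty hκ hC (fun ψ : p => hdef ψ ψ.2) fun T => by
    obtain ⟨a, ha⟩ := hp (Subtype.val '' (T : Set p)) (by simp) (T.finite_toSet.image _)
    exact ⟨a, Set.mem_iInter₂.2 fun ψ hψ => ha ψ (Set.mem_image_of_mem _ hψ)⟩
  exact ⟨a, fun ψ hψ => Set.mem_iInter.1 ha ⟨ψ, hψ⟩⟩

theorem HasIRDPattern.exists_realizations {κ : Cardinal.{w}} (hM : IsSaturated L M κ)
    (hκ : ℵ_ 1 ≤ κ) {A : Set M} (hA : #A < κ) {d m : ℕ} {π : Set (L[[A]].Formula (Fin d))}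
    (h : HasIRDPattern π m) :
    ∃ B : Set M, A ⊆ B ∧ #B < κ ∧ ∃ (k : Fin m → ℕ) (D : ∀ i, Set (Fin d ⊕ Fin (k i) → M))
      (c : ∀ i, ℕ → Fin (k i) → M) (a : (Fin m → ℕ) → Fin d → M), (∀ i, B.Definable L (D i)) ∧
        (∀ g, a g ∈ realizations M π) ∧ ∀ g i j, Sum.elim (a g) (c i j) ∈ D i ↔ g i < j := by
  obtain ⟨k, φ, c, hfs⟩ := h
  choose P _ hP using fun i => Set.definable_iff_finitely_definable.1
    (definable_univ_iff.2 ⟨φ i, fun _ => Iff.rfl⟩)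
  let B : Set M := A ∪ ⋃ i, (P i : Set M)
  have hB : #B < κ := mk_union_countable_lt hκ hA
    (Set.countable_iUnion fun i => (P i).finite_toSet.countable)
  have hD (i) : B.Definable L {v | (φ i).Realize v} :=
    (hP i).mono ((Set.subset_iUnion (fun i => (P i : Set M)) i).trans Set.subset_union_right)
  let C : Set M := B ∪ Set.range fun x : (Σ i, Fin (k i)) × ℕ => c x.1.1 x.2 x.1.2
  have hrealized (g) := (hfs g).realizations_nonempty hM hκ (C := C)
    (mk_union_countable_lt hκ hB (Set.countable_range _)) (by
      rintro ψ (⟨χ, -, rfl⟩ | ⟨i, j, rfl⟩)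
      · have hχ : A.Definable L {x : Fin d → M | χ.Realize x} := ⟨χ, rfl⟩
        simpa only [realize_onFormula_val] using!
          hχ.mono (Set.subset_union_left.trans Set.subset_union_left)
      · simpa only [realize_formulaIff, realize_plugIn] using! definable_iff_mem_iff
          (definable_fiber_right ((hD i).mono Set.subset_union_left)
            fun q => Or.inr (Set.mem_range_self (⟨⟨i, q⟩, j⟩ : (Σ i, Fin (k i)) × ℕ))) (g i < j))
  choose a ha using hrealized
  refine ⟨B, Set.subset_union_left, hB, k, _, c, a, hD, fun g χ hχ => ?_, fun g i j => ?_⟩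
  · exact (realize_onFormula_val χ _).1 (ha g _ (Or.inl (Set.mem_image_of_mem _ hχ)))
  · have := ha g _ (Or.inr ⟨i, j, rfl⟩)
    rwa [realize_formulaIff, realize_plugIn] at this

theorem RealizesEMType.mem {ι δ : Type*} {B : Set M} {a : (ι → ℕ) → δ → M}
    {b : (ι → ℚ) → δ → M} (hab : RealizesEMType L B a b) {D : Set (δ → M)}
    (hD : B.Definable L D) (ha : ∀ g, a g ∈ D) (x : ι → ℚ) : b x ∈ D :=
  hab Unit (fun _ => x) _ (hD.preimage_comp (Prod.mk ())) fun g _ => ha (g ())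

theorem RealizesEMType.cutsAxis {ι : Type} {δ γ : Type*} [Finite ι] [Finite δ] [Finite γ]
    {κ : Cardinal.{w}} (hM : IsSaturated L M κ) (hκ : ℵ_ 1 ≤ κ) {B : Set M} (hB : #B < κ)
    {a : (ι → ℕ) → δ → M} {b : (ι → ℚ) → δ → M} (hab : RealizesEMType L B a b)
    {D : Set (δ ⊕ γ → M)} (hD : B.Definable L D) {c : ℕ → γ → M} {i : ι}
    (hc : ∀ g j, Sum.elim (a g) (c j) ∈ D ↔ g i < j) : CutsAxis D b i := by
  classical
  intro ℓ
  suffices hfin : ∀ T : Finset {x : ι → ℚ // x i ≠ ℓ},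
      ∃ z, ∀ x ∈ T, Sum.elim (b x) z ∈ D ↔ x.1 i < ℓ by
    obtain ⟨z, hz⟩ := hM.exists_trace hκ hB hD (fun x : {x : ι → ℚ // x i ≠ ℓ} => b x)
      (fun x => x.1 i < ℓ) hfin
    exact ⟨z, fun x hx => hz ⟨x, hx⟩⟩
  intro T
  suffices hgrid : ∀ g : T → ι → ℕ, (∀ j x y, x.1.1 j < y.1.1 j → g x j < g y j) →
      ∃ z, ∀ x : T, Sum.elim (a (g x)) z ∈ D ↔ x.1.1 i < ℓ by
    obtain ⟨z, hz⟩ := hab T (fun x => x.1.1) _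
      (definable_exists_pattern hD fun x : T => x.1.1 i < ℓ) hgrid
    exact ⟨z, fun x hx => hz ⟨x, hx⟩⟩
  intro g hg
  let N : ℕ := (Finset.univ.filter fun x : T => x.1.1 i < ℓ).sup fun x => g x i + 1
  refine ⟨c N, fun x => (hc (g x) N).trans ⟨fun hxN => ?_, fun hxℓ => ?_⟩⟩
  · by_contra hxℓ
    have hℓx : ℓ < x.1.1 i := lt_of_le_of_ne (not_lt.1 hxℓ) x.1.2.symm
    exact hxN.not_ge (Finset.sup_le fun y hy =>
      hg i y x ((Finset.mem_filter.1 hy).2.trans hℓx))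
  · exact Finset.le_sup (f := fun y => g y i + 1) (Finset.mem_filter.2 ⟨Finset.mem_univ x, hxℓ⟩)

theorem HasIRDPattern.exists_grid (hNIP : IsNIPStructure L M) {κ : Cardinal.{w}}
    (hM : IsSaturated L M κ) (hκ : ℵ_ 1 ≤ κ) {A : Set M} (hA : #A < κ) {d m : ℕ}
    {π : Set (L[[A]].Formula (Fin d))} (h : HasIRDPattern π m) :
    ∃ b : (Fin m → ℚ) → Fin d → M, (∀ x, b x ∈ realizations M π) ∧
      ∃ U ∈ 𝓝 (0 : Fin m → ℚ), ∀ i, ∃ φ : L[[M]].Formula (Fin 2 × Fin d), ∀ x ∈ U, ∀ y ∈ U,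
        (x = y ∨ ∀ j, x j ≠ y j) → (φ.Realize (fun q => b (![x, y] q.1) q.2) ↔ x i < y i) := by
  obtain ⟨B, hAB, hB, k, D, c, a, hD, haπ, haD⟩ := h.exists_realizations hM hκ hA
  obtain ⟨b, hb, hab⟩ := hM.exists_isIndiscernibleGrid hκ hB a
  obtain ⟨U, hU, hW⟩ := hb.exists_nhds_forall_exists_definable_lt hM hκ hB hD
    (fun i => hNIP.hasFiniteVCDim ((hD i).mono (Set.subset_univ B)))
    fun i => hab.cutsAxis hM hκ hB (hD i) fun g j => haD g i j
  refine ⟨b, fun x χ hχ => ?_, U, hU, fun i => ?_⟩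
  · have hχA : A.Definable L {y : Fin d → M | χ.Realize y} := ⟨χ, rfl⟩
    exact hab.mem (hχA.mono hAB) (fun g => haπ g χ hχ) x
  · obtain ⟨W, hWdef, hWlt⟩ := hW i
    obtain ⟨φ, hφ⟩ := definable_univ_iff.1 hWdef
    exact ⟨φ, fun x hx y hy hxy => (hφ _).trans (hWlt x hx y hy hxy)⟩

end GridFromPattern

section MultiOrders

variable {m : ℕ} {X Y : Type} [(copies binLang m).Structure X] [(copies binLang m).Structure Y]

/-- The `i`-th order symbol of the language of `m` binary relations. -/
def ltSym (i : Fin m) : (copies binLang m).Relations 2 := (i, BinRel.lt)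

/-- The interpretation of the `i`-th order symbol. -/
def ordRel (i : Fin m) (a b : X) : Prop :=
  Structure.RelMap (ltSym i) ![a, b]

variable (m X) in
/-- A set with `m` strict linear orders, in the language with `m` binary relation symbols. -/
structure IsMultiOrder : Prop where
  irrefl : ∀ (i : Fin m) (a : X), ¬ ordRel i a a
  trans : ∀ (i : Fin m) (a b c : X), ordRel i a b → ordRel i b c → ordRel i a c
  total : ∀ (i : Fin m) (a b : X), a ≠ b → ordRel i a b ∨ ordRel i b a

theorem relMap_iff_ordRel (i : Fin m) (x : Fin 2 → X) :
    Structure.RelMap (ltSym i) x ↔ ordRel i (x 0) (x 1) := by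
  have hx : x = ![x 0, x 1] := by
    ext j
    fin_cases j <;> rfl
  rw [ordRel, ← hx]

theorem ordRel_map (f : X ↪[copies binLang m] Y) (i : Fin m) (a b : X) :
    ordRel i (f a) (f b) ↔ ordRel i a b :=
  (relMap_iff_ordRel i (f ∘ ![a, b])).symm.trans (f.map_rel (ltSym i) ![a, b])

theorem IsMultiOrder.asymm (hX : IsMultiOrder m X) {i : Fin m} {a b : X} (h : ordRel i a b) :
    ¬ ordRel i b a :=
  fun h' => hX.irrefl i a (hX.trans i a b a h h')

theorem IsMultiOrder.of_embedding (hY : IsMultiOrder m Y) (f : X ↪[copies binLang m] Y) :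
    IsMultiOrder m X where
  irrefl i a h := hY.irrefl i (f a) ((ordRel_map f i a a).2 h)
  trans i a b c hab hbc := (ordRel_map f i a c).1 <|
    hY.trans i _ (f b) _ ((ordRel_map f i a b).2 hab) ((ordRel_map f i b c).2 hbc)
  total i a b hab := by
    rw [← ordRel_map f, ← ordRel_map f]
    exact hY.total i _ _ (f.injective.ne hab)

theorem isMultiOrder_iff_mem_starPow [Finite X] :
    IsMultiOrder m X ↔ (⟨X, ‹_›⟩ : Bundled (copies binLang m).Structure) ∈ starPow LO m := by
  constructor
  · refine fun h => ⟨‹_›, fun i => ⟨‹_›, h.irrefl i, h.trans i, fun a b hab => ?_⟩⟩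
    exact (h.total i a b hab).imp (fun hab' => ⟨hab', h.asymm hab'⟩) fun hba => ⟨hba, h.asymm hba⟩
  · rintro ⟨-, h⟩
    refine ⟨fun i => (h i).2.1, fun i => (h i).2.2.1, fun i a b hab => ?_⟩
    exact ((h i).2.2.2 a b hab).imp And.left And.left

/-- A map preserving and reflecting each of at least one order, as an embedding of structures. -/
def multiOrderEmbedding (hm : 0 < m) (hX : IsMultiOrder m X) (hY : IsMultiOrder m Y) (f : X → Y)
    (hf : ∀ (i : Fin m) a b, ordRel i (f a) (f b) ↔ ordRel i a b) : X ↪[copies binLang m] Y where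
  toFun := f
  inj' a b hab := by
    by_contra hne
    rcases hX.total ⟨0, hm⟩ a b hne with h | h
    · rw [← hf, hab] at h
      exact hY.irrefl _ _ h
    · rw [← hf, hab] at h
      exact hY.irrefl _ _ h
  map_fun' g := isEmptyElim g
  map_rel' R x := by
    obtain ⟨i, R⟩ := R
    cases R
    exact (relMap_iff_ordRel i _).trans ((hf i _ _).trans (relMap_iff_ordRel i x).symm)

/-- `y` lies in the same cuts of `f(S)` as `x` does of `S`, for each of the `m` orders. -/
def RealizesCuts {S : Set X} (f : S → Y) (x : X) (y : Y) : Prop :=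
  ∀ (i : Fin m) (s : S), (ordRel i y (f s) ↔ ordRel i x s) ∧ (ordRel i (f s) y ↔ ordRel i (s : X) x)

theorem exists_extension_insert (hX : IsMultiOrder m X) (hY : IsMultiOrder m Y) {S : Set X}
    {f : S → Y} (hf : ∀ (i : Fin m) a b, ordRel i (f a) (f b) ↔ ordRel i (a : X) b)
    (hcut : ∀ x ∉ S, ∃ y, RealizesCuts (m := m) f x y) (x : X) :
    ∃ F : X → Y, (∀ s : S, F s = f s) ∧ ∀ (i : Fin m), ∀ a ∈ insert x S, ∀ b ∈ insert x S,
      (ordRel i (F a) (F b) ↔ ordRel i a b) := by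
  classical
  obtain ⟨y, hyS, hy⟩ : ∃ y, (∀ h : x ∈ S, y = f ⟨x, h⟩) ∧ RealizesCuts (m := m) f x y := by
    by_cases hx : x ∈ S
    · exact ⟨f ⟨x, hx⟩, fun _ => rfl, fun i s => ⟨hf i ⟨x, hx⟩ s, hf i s ⟨x, hx⟩⟩⟩
    · obtain ⟨y, hy⟩ := hcut x hx
      exact ⟨y, fun h => absurd h hx, hy⟩
  let F : X → Y := fun a => if h : a ∈ S then f ⟨a, h⟩ else y
  have hFS (s : S) : F s = f s := dif_pos s.2
  have hFx : F x = y := by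
    by_cases hx : x ∈ S
    · exact (hFS ⟨x, hx⟩).trans (hyS hx).symm
    · exact dif_neg hx
  refine ⟨F, hFS, fun i => ?_⟩
  rintro a (rfl | ha) b (rfl | hb)
  · exact iff_of_false (hY.irrefl i _) (hX.irrefl i _)
  · rw [hFx, hFS ⟨b, hb⟩]
    exact (hy i ⟨b, hb⟩).1
  · rw [hFx, hFS ⟨a, ha⟩]
    exact (hy i ⟨a, ha⟩).2
  · rw [hFS ⟨a, ha⟩, hFS ⟨b, hb⟩]
    exact hf i ⟨a, ha⟩ ⟨b, hb⟩

theorem isExtensionPair_of_forall_exists_realizesCuts (hm : 0 < m) (hX : IsMultiOrder m X)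
    (hY : IsMultiOrder m Y)
    (h : ∀ (S : Set X) [Finite S] (f : S → Y),
      (∀ (i : Fin m) a b, ordRel i (f a) (f b) ↔ ordRel i (a : X) b) →
        ∀ x ∉ S, ∃ y, RealizesCuts (m := m) f x y) :
    (copies binLang m).IsExtensionPair X Y := by
  rw [isExtensionPair_iff_exists_embedding_closure_singleton_sup]
  intro S hS f x
  have hfin : Finite (S : Set X) := hS.finite
  have hf (i : Fin m) (a b : (S : Set X)) : ordRel i (f a) (f b) ↔ ordRel i (a : X) b :=
    (ordRel_map f i a b).trans (ordRel_map S.subtype i a b).symm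
  obtain ⟨F, hFS, hF⟩ := exists_extension_insert hX hY hf (h (S : Set X) f hf) x
  have hmem : ∀ y ∈ (Substructure.closure (copies binLang m) {x} ⊔ S :
      (copies binLang m).Substructure X), y ∈ insert x (S : Set X) := by
    intro y hy
    rwa [← Substructure.closure_eq S, ← Substructure.closure_union,
      Substructure.mem_closure_iff_of_isRelational] at hy
  refine ⟨multiOrderEmbedding hm (hX.of_embedding (Substructure.subtype _)) hY (fun y => F y)
    fun i a b => (hF i a (hmem a a.2) b (hmem b b.2)).trans
      (ordRel_map (Substructure.subtype _) i a b),
    Embedding.ext fun s => (hFS s).symm⟩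

end MultiOrders

section CoordinateOrders

variable {m : ℕ}

/-- The structure on `X` whose `m` relations compare the values of `m` coordinate functions. -/
@[reducible] def coordStructure {X : Type} {O : Type*} [LT O] (c : X → Fin m → O) :
    (copies binLang m).Structure X where
  funMap f := isEmptyElim f
  RelMap R x := match R with
    | (i, BinRel.lt) => c (x 0) i < c (x 1) i

theorem isMultiOrder_coordStructure {X : Type} {O : Type*} [LinearOrder O] {c : X → Fin m → O}
    (hc : ∀ i, Function.Injective fun x => c x i) :
    @IsMultiOrder m X (coordStructure c) :=
  letI := coordStructure c
  { irrefl := fun i a => lt_irrefl (c a i)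
    trans := fun i a b d => lt_trans (a := c a i) (b := c b i) (c := c d i)
    total := fun i _ _ hab => lt_or_gt_of_ne ((hc i).ne hab) }

theorem exists_gap_of_forall_lt {S O : Type*} [Finite S] [LinearOrder O] [DenselyOrdered O]
    [NoMinOrder O] [NoMaxOrder O] [Nonempty O] (c : S → O) {P Q : S → Prop}
    (h : ∀ s t, P s → Q t → c s < c t) :
    ∃ u v, u < v ∧ (∀ s, P s → c s < u) ∧ ∀ t, Q t → v < c t := by
  classical
  cases nonempty_fintype S
  obtain ⟨u, hPu, huQ⟩ := Order.exists_between_finsets ((Finset.univ.filter P).image c)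
    ((Finset.univ.filter Q).image c) (by simpa using! fun s hs t ht => h s t hs ht)
  obtain ⟨v, huv, hvQ⟩ := Order.exists_between_finsets {u} ((Finset.univ.filter Q).image c)
    (by simpa using huQ)
  simp only [Finset.mem_image, Finset.mem_filter, Finset.mem_univ, true_and, forall_exists_index,
    and_imp, forall_apply_eq_imp_iff₂, Finset.mem_singleton, forall_eq] at hPu huv hvQ
  exact ⟨u, v, huv, hPu, hvQ⟩

theorem isExtensionPair_coordStructure {Y : Type} {O : Type*} [LinearOrder O] [DenselyOrdered O]
    [NoMinOrder O] [NoMaxOrder O] [Nonempty O] {c : Y → Fin m → O}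
    (hc : ∀ i, Function.Injective fun y => c y i)
    (hdense : ∀ u v : Fin m → O, (∀ i, u i < v i) → ∃ y, ∀ i, u i < c y i ∧ c y i < v i)
    (hm : 0 < m) {X : Type} [(copies binLang m).Structure X] (hX : IsMultiOrder m X) :
    letI := coordStructure c
    (copies binLang m).IsExtensionPair X Y := by
  let := coordStructure c
  refine isExtensionPair_of_forall_exists_realizesCuts hm hX (isMultiOrder_coordStructure hc)
    fun S _ f hf x hx => ?_
  have hgap (i : Fin m) := exists_gap_of_forall_lt (fun s : S => c (f s) i)
    (P := fun s => ordRel i (s : X) x) (Q := fun s => ordRel i x (s : X))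
    fun s t hs ht => (hf i s t).2 (hX.trans i _ _ _ hs ht)
  choose u v huv hu hv using hgap
  obtain ⟨y, hy⟩ := hdense u v huv
  refine ⟨y, fun i s => ?_⟩
  have hsx : (s : X) ≠ x := fun e => hx (e ▸ s.2)
  rcases hX.total i s x hsx with h | h
  · have hlt : c (f s) i < c y i := (hu i s h).trans (hy i).1
    exact ⟨iff_of_false hlt.not_gt (hX.asymm h), iff_of_true hlt h⟩
  · have hlt : c y i < c (f s) i := (hy i).2.trans (hv i s h)
    exact ⟨iff_of_true hlt h, iff_of_false hlt.not_gt (hX.asymm h)⟩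

end CoordinateOrders

section GenericGrid

variable {m : ℕ}

/-- The underlying set of a concrete Fraïssé limit of the finite sets with `m` linear orders. -/
def GenericGrid (m : ℕ) : Type := (Fin m → ℚ) × ℕ

instance : Countable (GenericGrid m) := inferInstanceAs (Countable ((Fin m → ℚ) × ℕ))

noncomputable instance : Encodable (GenericGrid m) :=
  inferInstanceAs (Encodable ((Fin m → ℚ) × ℕ))

/-- The `i`-th coordinate of a point: a rational number perturbed by an irrational shift that
identifies the point. -/
noncomputable def gridCoord (x : GenericGrid m) (i : Fin m) : ℝ :=
  x.1 i + √2 / (Encodable.encode x + 1)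

theorem gridCoord_injective (i : Fin m) :
    Function.Injective fun x : GenericGrid m => gridCoord x i := by
  intro x y hxy
  simp only [gridCoord] at hxy
  by_contra hne
  have hcode : (Encodable.encode y : ℝ) - Encodable.encode x ≠ 0 :=
    sub_ne_zero.2 fun e => hne (Encodable.encode_injective (Nat.cast_injective e)).symm
  refine irrational_sqrt_two.ne_rat ((y.1 i - x.1 i) * (Encodable.encode x + 1) *
    (Encodable.encode y + 1) / (Encodable.encode y - Encodable.encode x)) ?_
  push_cast
  rw [eq_div_iff hcode]
  field_simp at hxy
  linear_combination hxy

theorem exists_gridCoord_between {u v : Fin m → ℝ} (h : ∀ i, u i < v i) :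
    ∃ x : GenericGrid m, ∀ i, u i < gridCoord x i ∧ gridCoord x i < v i := by
  choose p hup hpv using fun i => exists_rat_btwn (h i)
  let shift (k : ℕ) : ℝ := √2 / (Encodable.encode ((p, k) : GenericGrid m) + 1)
  have hcode : Function.Injective fun k : ℕ => Encodable.encode ((p, k) : GenericGrid m) :=
    fun k l hkl => (Prod.ext_iff.1 (Encodable.encode_injective hkl)).2
  have hlim : Filter.Tendsto shift Filter.atTop (nhds 0) :=
    tendsto_const_nhds.div_atTop <| Filter.tendsto_atTop_add_const_right _ _ <|
      tendsto_natCast_atTop_atTop.comp hcode.nat_tendsto_atTop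
  obtain ⟨k, hk⟩ := (Filter.eventually_all.2 fun i =>
    hlim.eventually_lt_const (sub_pos.2 (hpv i))).exists
  exact ⟨(p, k), fun i => ⟨(hup i).trans (lt_add_of_pos_right _ (by positivity)),
    lt_sub_iff_add_lt'.1 (hk i)⟩⟩

noncomputable instance : (copies binLang m).Structure (GenericGrid m) :=
  coordStructure gridCoord

instance : IsEmpty (copies binLang m).Constants :=
  inferInstanceAs (IsEmpty Empty)

instance : IsEmpty ((copies binLang m).Relations 0) :=
  ⟨fun R => nomatch R.2⟩

theorem isMultiOrder_genericGrid : IsMultiOrder m (GenericGrid m) :=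
  isMultiOrder_coordStructure gridCoord_injective

theorem isExtensionPair_genericGrid (hm : 0 < m) {X : Type} [(copies binLang m).Structure X]
    (hX : IsMultiOrder m X) : (copies binLang m).IsExtensionPair X (GenericGrid m) :=
  isExtensionPair_coordStructure gridCoord_injective (fun _ _ => exists_gridCoord_between) hm hX

theorem nonempty_embedding_genericGrid (hm : 0 < m) {X : Type} [(copies binLang m).Structure X]
    [Countable X] (hX : IsMultiOrder m X) : Nonempty (X ↪[copies binLang m] GenericGrid m) :=
  let ⟨f, _⟩ := embedding_from_cg
    (Structure.cg_def.2 (Substructure.cg_iff_countable.2 inferInstance)) default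
    (isExtensionPair_genericGrid hm hX)
  ⟨f⟩

theorem isFraisseLimit_genericGrid (hm : 0 < m) :
    IsFraisseLimit (starPow LO m) (GenericGrid m) where
  ultrahomogeneous := (isUltrahomogeneous_iff_IsExtensionPair
    (Structure.cg_def.2 (Substructure.cg_iff_countable.2 inferInstance))).2
    (isExtensionPair_genericGrid hm isMultiOrder_genericGrid)
  age := by
    ext B
    constructor
    · rintro ⟨hfg, ⟨f⟩⟩
      have : Finite B := Structure.fg_iff_finite.1 hfg
      exact isMultiOrder_iff_mem_starPow.1 (isMultiOrder_genericGrid.of_embedding f)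
    · intro hB
      have : Finite B := hB.1
      exact ⟨Structure.fg_iff_finite.2 this,
        nonempty_embedding_genericGrid hm (isMultiOrder_iff_mem_starPow.2 hB)⟩

end GenericGrid

section Comparison

open scoped Topology

theorem exists_forall_mem_forall_lt_iff_lt {ι X O : Type*} [Finite ι] [Countable X] [LinearOrder O]
    (c : X → ι → O) {U : Set (ι → ℚ)} (hU : U ∈ 𝓝 0) :
    ∃ e : X → ι → ℚ, (∀ x, e x ∈ U) ∧ ∀ i x y, e x i < e y i ↔ c x i < c y i := by
  rw [nhds_pi] at hU
  obtain ⟨⟨I, ε⟩, ⟨-, hε⟩, hIU⟩ := (nhds_basis_Ioo_pos (0 : ℚ)).pi_self.mem_iff.1 hU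
  have : Nontrivial (Set.Ioo (0 - ε) (0 + ε)) :=
    Set.nontrivial_coe_sort.2 (Set.Ioo_infinite (by linarith)).nontrivial
  have hembed (i : ι) : Nonempty (Set.range (c · i) ↪o Set.Ioo (0 - ε) (0 + ε)) :=
    have := (Set.countable_range (c · i)).to_subtype
    Order.embedding_from_countable_to_dense _ _
  let e (i : ι) := (hembed i).some
  exact ⟨fun x i => e i ⟨c x i, Set.mem_range_self x⟩, fun x => hIU fun i _ => (e i _).2,
    fun i x y => (e i).lt_iff_lt⟩

variable {L : FirstOrder.Language.{u, v}} {M : Type w} [L.Structure M] {A : Set M} {d m : ℕ}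
  {π : Set (L[[A]].Formula (Fin d))}

theorem HasIRDPattern.hasConfiguration (h : HasIRDPattern π m) (hm : 0 < m)
    (hNIP : IsNIPStructure L M) {κ : Cardinal.{w}} (hM : IsSaturated L M κ) (hκ : ℵ_ 1 ≤ κ)
    (hA : #A < κ) : HasConfiguration (starPow LO m) π := by
  obtain ⟨b, hb, U, hU, hφ⟩ := h.exists_grid hNIP hM hκ hA
  obtain ⟨e, heU, he⟩ := exists_forall_mem_forall_lt_iff_lt (gridCoord (m := m)) hU
  have hinj (i : Fin m) : Function.Injective fun x => e x i := by
    intro x y hxy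
    have hnlt {x y} (hxy : e x i = e y i) : ¬ gridCoord x i < gridCoord y i :=
      fun hlt => ((he i x y).2 hlt).ne hxy
    exact gridCoord_injective i (le_antisymm (not_lt.1 (hnlt hxy.symm)) (not_lt.1 (hnlt hxy)))
  refine ⟨GenericGrid m, inferInstance, inferInstance, isFraisseLimit_genericGrid hm,
    fun x => b (e x), fun x => hb _, ?_⟩
  rintro _ ⟨i, ⟨⟩⟩
  obtain ⟨φ, hφ⟩ := hφ i
  refine ⟨φ, fun x => ?_⟩
  have hx01 : e (x 0) = e (x 1) ∨ ∀ j, e (x 0) j ≠ e (x 1) j :=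
    (eq_or_ne (x 0) (x 1)).imp (congrArg e) fun hne j => (hinj j).ne hne
  have hpair : (fun q : Fin 2 × Fin d => b (e (x q.1)) q.2) =
      fun q => b (![e (x 0), e (x 1)] q.1) q.2 := by
    funext ⟨q, j⟩
    fin_cases q <;> rfl
  rw [hpair, hφ _ (heU _) _ (heU _) hx01, he]
  exact relMap_iff_ordRel i x

/-- The position in the `i`-th order of the parameter `(i, j)`, or of the realization of the branch
`g`, of an IRD-pattern to be built. Parameters are even and realizations odd, so that `g` comes
before `(i, j)` if and only if `g i < j`. -/
def patternPos (x : (Fin m × ℕ) ⊕ (Fin m → ℕ)) (i : Fin m) : ℕ :=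
  x.elim (fun p => 2 * p.2) (fun g => 2 * g i + 1)

theorem exists_ordRel_iff_lt_of_isFraisseLimit {Γ : Type} [(copies binLang m).Structure Γ]
    [Countable Γ] (hΓ : IsFraisseLimit (starPow LO m) Γ) (hm : 0 < m) :
    ∃ (p : Fin m → ℕ → Γ) (r : (Fin m → ℕ) → Γ), ∀ g i j, ordRel i (r g) (p i j) ↔ g i < j := by
  let c (x : (Fin m × ℕ) ⊕ (Fin m → ℕ)) (i : Fin m) : ℕ ×ₗ ℕ :=
    toLex (patternPos x i, Encodable.encode x)
  let := coordStructure c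
  obtain ⟨e⟩ := nonempty_embedding_genericGrid hm (isMultiOrder_coordStructure (c := c)
    fun i x y hxy => Encodable.encode_injective (Prod.ext_iff.1 (toLex.injective hxy)).2)
  obtain ⟨E⟩ := (isFraisseLimit_genericGrid hm).nonempty_equiv hΓ
  let f := E.toEmbedding.comp e
  refine ⟨fun i j => f (Sum.inl (i, j)), fun g => f (Sum.inr g), fun g i j => ?_⟩
  rw [ordRel_map]
  refine (Prod.Lex.toLex_lt_toLex (x := (2 * g i + 1, _)) (y := (2 * j, _))).trans ?_
  simp only
  omega

theorem HasConfiguration.hasIRDPattern (h : HasConfiguration (starPow LO m) π) (hm : 0 < m) :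
    HasIRDPattern π m := by
  obtain ⟨Γ, _, _, hΓ, f, hfπ, hf⟩ := h
  obtain ⟨p, r, hlt⟩ := exists_ordRel_iff_lt_of_isFraisseLimit hΓ hm
  choose φ hφ using fun i : Fin m => hf 2 (ltSym i)
  refine ⟨fun _ => d, fun i => (φ i).relabel fun q => if q.1 = 0 then Sum.inl q.2 else Sum.inr q.2,
    fun i j => f (p i j), fun g F hF _ => ⟨f (r g), fun ψ hψ => ?_⟩⟩
  rcases hF hψ with ⟨χ, hχ, rfl⟩ | ⟨i, j, rfl⟩
  · exact (realize_onFormula_val χ _).2 (hfπ _ χ hχ)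
  · rw [realize_formulaIff, realize_plugIn, Formula.realize_relabel, ← hlt, ordRel, hφ]
    refine iff_of_eq (congrArg (φ i).Realize ?_)
    funext ⟨q, l⟩
    fin_cases q <;> rfl

theorem HasIRDPattern.mono {n : ℕ} (hnm : n ≤ m) (h : HasIRDPattern π m) : HasIRDPattern π n := by
  obtain ⟨k, φ, c, h⟩ := h
  refine ⟨fun i => k (Fin.castLE hnm i), fun i => φ (Fin.castLE hnm i),
    fun i => c (Fin.castLE hnm i), fun g F hF hfin => ?_⟩
  refine h (fun i => if hi : (i : ℕ) < n then g ⟨i, hi⟩ else 0) F (hF.trans ?_) hfin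
  refine Set.union_subset_union_right _ ?_
  rintro _ ⟨i, j, rfl⟩
  exact ⟨Fin.castLE hnm i, j, by simp⟩

theorem FinitelySatisfiable.liftParams (h : FinitelySatisfiable M π) :
    FinitelySatisfiable M (liftParams π) := by
  intro F hF hfin
  obtain ⟨F', hF', hfin', rfl⟩ := hfin.exists_subset_finite_image_eq hF
  obtain ⟨a, ha⟩ := h F' hF' hfin'
  refine ⟨a, ?_⟩
  rintro _ ⟨φ, hφ, rfl⟩
  exact (realize_onFormula_val φ a).2 (ha φ hφ)

theorem hasIRDPattern_zero (h : FinitelySatisfiable M π) : HasIRDPattern π 0 := by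
  refine ⟨fun i => i.elim0, fun i => i.elim0, fun i => i.elim0, fun g F hF hfin => ?_⟩
  refine h.liftParams F (fun ψ hψ => (hF hψ).resolve_right ?_) hfin
  rintro ⟨i, -⟩
  exact i.elim0

theorem natCast_le_opDim_iff (h : FinitelySatisfiable M π) {n : ℕ} :
    (n : ℕ∞) ≤ opDim π ↔ HasIRDPattern π n := by
  refine ⟨fun hn => ?_, fun hn => le_iSup₂_of_le n hn le_rfl⟩
  obtain _ | k := n
  · exact hasIRDPattern_zero h
  · have hk : (k : ℕ∞) < opDim π := (Nat.cast_lt.2 k.lt_succ_self).trans_le hn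
    obtain ⟨l, hl⟩ := lt_iSup_iff.1 hk
    obtain ⟨hπl, hkl⟩ := lt_iSup_iff.1 hl
    exact hπl.mono (Nat.succ_le_of_lt (Nat.cast_lt.1 hkl))

theorem natCast_le_rank_iff {L₀ : FirstOrder.Language.{0, 0}} [L₀.IsRelational]
    {K : Set (Bundled.{0} L₀.Structure)} {n : ℕ} :
    (n : ℕ∞) ≤ rank K π ↔ ∀ k, ¬ HasConfiguration (starPow K (k + 1)) π → n ≤ k := by
  simp only [rank, le_iInf_iff, Nat.cast_le]

theorem rank_eq_opDim (hπ : FinitelySatisfiable M π)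
    (h : ∀ n, 0 < n → (HasConfiguration (starPow LO n) π ↔ HasIRDPattern π n)) :
    rank LO π = opDim π := by
  refine ENat.eq_of_forall_natCast_le_iff fun n => ?_
  simp only [natCast_le_rank_iff, natCast_le_opDim_iff hπ, h _ (Nat.succ_pos _)]
  refine ⟨fun hn => ?_, fun hn k hk => ?_⟩
  · by_contra hc
    obtain _ | k := n
    · exact hc (hasIRDPattern_zero hπ)
    · exact (hn k hc).not_gt k.lt_succ_self
  · by_contra hlt
    exact hk (hn.mono (Nat.succ_le_of_lt (not_le.1 hlt)))

end Comparison

end KRank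

theorem mainTheorem2_general {L : FirstOrder.Language.{u, v}} (M : Type w) [L.Structure M]
    (hNIP : KRank.IsNIPStructure L M) (κ : Cardinal.{w}) (hκ : ℵ_ 1 ≤ κ)
    (hM : KRank.IsSaturated L M κ) (A : Set M) (hA : #A < κ) (d : ℕ)
    (π : Set (L[[A]].Formula (Fin d))) (hπ : KRank.FinitelySatisfiable M π) :
    KRank.rank KRank.LO π = KRank.opDim π :=
  KRank.rank_eq_opDim hπ fun _ hn =>
    ⟨fun h => h.hasIRDPattern hn, fun h => h.hasConfiguration hn hNIP hM hκ hA⟩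

/-- If `T` is a complete theory with NIP, then in a monster model of `T` the linear order rank of
each partial type over a small set equals its op-dimension. -/
theorem mainTheorem2 {L : FirstOrder.Language.{u, v}} (T : L.Theory) (hT : T.IsComplete)
    (hNIP : KRank.IsNIP.{u, v, w} T)
    (M : Type w) [L.Structure M] [Nonempty M] [M ⊨ T]
    (κ : Cardinal.{w}) (hκ : Cardinal.aleph 1 ≤ κ) (hM : KRank.IsSaturated L M κ)
    (A : Set M) (hA : Cardinal.mk A < κ) (d : ℕ) (π : Set (L[[A]].Formula (Fin d)))
    (hπ : KRank.FinitelySatisfiable M π) :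
    KRank.rank KRank.LO π = KRank.opDim π :=
  mainTheorem2_general M (fun n m φ => (hNIP n m φ).imp fun _ hk => hk M) κ hκ hM A hA d π hπ
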